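/- **Conventions.** Put $C_1=\begin{pmatrix}1&0\\0&1\end{pmatrix}$, $C_2=\begin{pmatrix}0&0\\1&0\end{pmatrix}$, $D=\begin{pmatrix}1&0\\0&-1\end{pmatrix}$, $E=\begin{pmatrix}0&1\\0&0\end{pmatrix}$. A $(TE)$-structure (of rank $2$ over the germ $(\mathbb C^2,0)$ with coordinates $(t_1,t_2)$) is a flat connection with connection form $\Omega=z^{-1}A_1\,dt_1+z^{-1}A_2\,dt_2+z^{-2}B\,dz$, where $A_1,A_2,B$ are $2\times2$ matrices of germs at $0$ of holomorphic functions of $(z,t_1,t_2)$; flatness means $$z\partial_iA_j-z\partial_jA_i+[A_i,A_j]=0,\qquad z\partial_iB-z^2\partial_zA_i+zA_i+[A_i,B]=0 .$$ Two $(TE)$-structures $(A_i,B)$ and $(\tilde A_i,\tilde B)$ are (holomorphically) isomorphic if there are a germ of a biholomorphic map $h:(\mathbb C^2,0)\to(\mathbb C^2,0)$ and a germ at $0$ of an invertible holomorphic matrix $T(z,t)$ such that $\tilde T(z,t):=T(z,h(t))$ satisfies $$z\partial_i\tilde T+\sum_j(\partial_ih^j)(A_j\circ h)\tilde T-\tilde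 T\tilde A_i=0\ (i=1,2),\qquad z^2\partial_z\tilde T+(B\circ h)\tilde T-\tilde T\tilde B=0 .$$ For $B_0^o,B_\infty\in M_{2\times2}(\mathbb C)$ with $B_0^o$ not a multiple of the identity, put $(B_0)_\Gamma:=B_0^o-\Gamma+[B_\infty,\Gamma]$ for $\Gamma\in M_{2\times 2}(\mathbb C)$. Let $M^{\rm univ}$ be the germ at $\Gamma=0$ of the integral submanifold through $0$ of the distribution $\mathcal D_\Gamma=\mathrm{span}_{\mathbb C}\{\mathrm{Id},(B_0)_\Gamma\}$. The Malgrange universal deformation $\nabla^{\mathrm{univ},B_0^o,B_\infty}$ is the connection on the trivial rank two bundle over $(\mathbb C,0)\times M^{\rm univ}$ with connection form $\left(\frac{B_0}{z}+B_\infty\right)\frac{dz}{z}+\frac{\mathcal C}{z}$, where $\mathcal C_X=X$ for $X\in T_\Gamma M^{\rm univ}\subset M_{2\times2}(\mathbb C)$. In a local parametrization $\varphi:(\mathbb C^2,0)\to (M^{\rm univ},0)$ it is thus given by $A_i=\partial_i\varphi$ and $B=(B_0)_{\varphi(t)}+zB_\infty$. **Theorem.** Let $c,c_0\in\mathbb C$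 with $c_0\ne0$, $B_0^o=cC_1+c_0C_2$, and let $B_\infty=(B^\infty_{ij})\in M_{2\times2}(\mathbb C)$ satisfy $B^\infty_{12}=c_0$, $B^\infty_{11}-B^\infty_{22}=-\frac12$ and $B^\infty_{21}\neq0$. Put $\alpha=\frac12(B^\infty_{11}+B^\infty_{22})$, let $a,b\in\mathbb C$ be such that $a+b=-\frac1{2B^\infty_{21}}$ and $ab=-\frac{c_0}{B^\infty_{21}}$, and put $\lambda=B^\infty_{21}(b-a)-1$. Then $M^{\rm univ}$ exists, $\nabla=\nabla^{\mathrm{univ},B_0^o,B_\infty}$ is, in any local parametrization of $M^{\rm univ}$ sending $0$ to $0$, a $(TE)$-structure (a non-elementary Malgrange normal form of the second type), and the following holds. i) If $B^\infty_{12}B^\infty_{21}=-\frac1{16}$, then $\nabla$ is isomorphic to the $(TE)$-structure $$\tilde A_1=C_1,\quad \tilde A_2=C_2+\frac{z\,c_0^2}{1-t_2}E,\quad \tilde B=(-t_1+c+\alpha z)C_1+(1-t_2)C_2+z\,c_0^2E .$$ ii) If $B^\infty_{12}B^\infty_{21}\ne-\frac1{16}$ and $B^\infty_{21}(b-a)\neq1$,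 then $\nabla$ is isomorphic to the $(TE)$-structure $$\tilde A_1=C_1,\quad \tilde A_2=C_2+z\left(\tfrac{\lambda}{c_0}t_2+1\right)^{-2-\frac1\lambda}E,$$ $$\tilde B=(-t_1+c+\alpha z)C_1+(\lambda t_2+c_0)C_2-\tfrac z2(\lambda+1)D+z\,c_0\left(\tfrac{\lambda}{c_0}t_2+1\right)^{-1-\frac1\lambda}E,$$ where the powers are the branches (principal) with value $1$ at $t_2=0$. iii) If $B^\infty_{12}B^\infty_{21}\ne-\frac1{16}$ and $B^\infty_{21}(b-a)=1$, then $\nabla$ is isomorphic to the $(TE)$-structure $$\tilde A_1=C_1,\quad \tilde A_2=C_2+z\,c_0^2e^{-t_2}E,\quad \tilde B=(-t_1+c+\alpha z)C_1+C_2-\tfrac z2D+z\,c_0^2e^{-t_2}E .$$ -/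

import Mathlib

open Filter Topology

/-- A matrix-valued function is holomorphic near `p` (entrywise). -/
def MatHolomorphicAt {V : Type*} [NormedAddCommGroup V] [NormedSpace ℂ V] {r : ℕ}
    (F : V → Matrix (Fin r) (Fin r) ℂ) (p : V) : Prop :=
  ∀ i j, AnalyticAt ℂ (fun q => F q i j) p

/-- The entrywise derivative of a matrix-valued function at `p` in the direction `v`. -/
noncomputable def matDeriv {V : Type*} [NormedAddCommGroup V] [NormedSpace ℂ V] {r : ℕ}
    (F : V → Matrix (Fin r) (Fin r) ℂ) (p v : V) : Matrix (Fin r) (Fin r) ℂ :=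
  Matrix.of fun i j => fderiv ℂ (fun q => F q i j) p v

/-- The partial derivative `∂F/∂t_i` of a function of `(z, t) ∈ ℂ × ℂ^m`. -/
noncomputable def pdT {m r : ℕ} (i : Fin m) (F : ℂ × (Fin m → ℂ) → Matrix (Fin r) (Fin r) ℂ)
    (p : ℂ × (Fin m → ℂ)) : Matrix (Fin r) (Fin r) ℂ :=
  matDeriv F p (0, Pi.single i 1)

/-- The partial derivative `∂F/∂z` of a function of `(z, t) ∈ ℂ × ℂ^m`. -/
noncomputable def pdZ {m r : ℕ} (F : ℂ × (Fin m → ℂ) → Matrix (Fin r) (Fin r) ℂ)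
    (p : ℂ × (Fin m → ℂ)) : Matrix (Fin r) (Fin r) ℂ :=
  matDeriv F p (1, 0)

/-- Matrices `A_1, …, A_m, B`, functions of `(z, t)`, of the connection form
`Ω = ∑ z⁻¹ A_i dt_i + z⁻² B dz` on the trivial bundle of rank `r` over `(ℂ, 0) × (ℂ^m, 0)`. -/
structure TEData (m r : ℕ) where
  A : Fin m → ℂ × (Fin m → ℂ) → Matrix (Fin r) (Fin r) ℂ
  B : ℂ × (Fin m → ℂ) → Matrix (Fin r) (Fin r) ℂ

/-- The matrices are holomorphic near the origin and the connection is flat, that is,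
they define a (germ of a) `(TE)`-structure. -/
structure TEData.IsTEStructure {m r : ℕ} (S : TEData m r) : Prop where
  holomorphic_A : ∀ i, MatHolomorphicAt (S.A i) 0
  holomorphic_B : MatHolomorphicAt S.B 0
  flat_tt : ∀ i j, ∀ᶠ p in 𝓝 (0 : ℂ × (Fin m → ℂ)),
    p.1 • pdT i (S.A j) p - p.1 • pdT j (S.A i) p
      + (S.A i p * S.A j p - S.A j p * S.A i p) = 0
  flat_tz : ∀ i, ∀ᶠ p in 𝓝 (0 : ℂ × (Fin m → ℂ)),
    p.1 • pdT i S.B p - p.1 ^ 2 • pdZ (S.A i) p + p.1 • S.A i p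
      + (S.A i p * S.B p - S.B p * S.A i p) = 0

/-- `(T, h)` is a holomorphic isomorphism between the germs `S` and `S'`: `h` is a biholomorphic
germ of `(ℂ^m, 0)`, `T` is a germ of an invertible holomorphic matrix, and with
`T' (z, t) = T (z, h t)` one has
`z ∂_i T' + ∑_j (∂_i h^j) (A_j ∘ h) T' - T' A'_i = 0` and `z² ∂_z T' + (B ∘ h) T' - T' B' = 0`. -/
structure TEData.IsIso {m r : ℕ} (S S' : TEData m r)
    (T : ℂ × (Fin m → ℂ) → Matrix (Fin r) (Fin r) ℂ) (h : (Fin m → ℂ) → (Fin m → ℂ)) :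
    Prop where
  holomorphic_h : AnalyticAt ℂ h 0
  h_zero : h 0 = 0
  bijective_h : Function.Bijective (fderiv ℂ h 0)
  holomorphic_T : MatHolomorphicAt T 0
  invertible_T : IsUnit (T 0)
  eq_t : ∀ i, ∀ᶠ p in 𝓝 (0 : ℂ × (Fin m → ℂ)),
    p.1 • pdT i (fun q => T (q.1, h q.2)) p
      + ∑ j, fderiv ℂ h p.2 (Pi.single i 1) j • (S.A j (p.1, h p.2) * T (p.1, h p.2))
      - T (p.1, h p.2) * S'.A i p = 0
  eq_z : ∀ᶠ p in 𝓝 (0 : ℂ × (Fin m → ℂ)),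
    p.1 ^ 2 • pdZ (fun q => T (q.1, h q.2)) p
      + S.B (p.1, h p.2) * T (p.1, h p.2) - T (p.1, h p.2) * S'.B p = 0

/-- The two germs are holomorphically isomorphic. -/
def TEData.Isomorphic {m r : ℕ} (S S' : TEData m r) : Prop :=
  ∃ T h, S.IsIso S' T h

/-- The matrix `(B_0)_Γ = B_0^o - Γ + [B_∞, Γ]`. -/
def malgrangeB0 {n : ℕ} (B0 Binf Γ : Matrix (Fin n) (Fin n) ℂ) : Matrix (Fin n) (Fin n) ℂ :=
  B0 - Γ + (Binf * Γ - Γ * Binf)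

/-- `φ` is a holomorphic parametrization, near the origin of `ℂ^n`, of the germ at `Γ = 0` of the
integral submanifold `M^univ` through `0` of the distribution
`D_Γ = span {Id, (B_0)_Γ, …, (B_0)_Γ^(n-1)}` on the space of matrices. -/
structure IsMalgrangeChart {n : ℕ} (B0 Binf : Matrix (Fin n) (Fin n) ℂ)
    (φ : (Fin n → ℂ) → Matrix (Fin n) (Fin n) ℂ) : Prop where
  holomorphic : MatHolomorphicAt φ 0
  map_zero : φ 0 = 0
  immersion : LinearIndependent ℂ fun i : Fin n => matDeriv φ 0 (Pi.single i 1)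
  tangent : ∀ᶠ t in 𝓝 (0 : Fin n → ℂ),
    Submodule.span ℂ (Set.range fun i : Fin n => matDeriv φ t (Pi.single i 1)) =
      Submodule.span ℂ (Set.range fun k : Fin n => malgrangeB0 B0 Binf (φ t) ^ (k : ℕ))

/-- The Malgrange universal connection, with connection form
`(B_0 / z + B_∞) dz / z + C / z`, `C_X = X`, written in the coordinates given by `φ`. -/
noncomputable def malgrangeUniv {n : ℕ} (B0 Binf : Matrix (Fin n) (Fin n) ℂ)
    (φ : (Fin n → ℂ) → Matrix (Fin n) (Fin n) ℂ) : TEData n n where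
  A i p := matDeriv φ p.2 (Pi.single i 1)
  B p := malgrangeB0 B0 Binf (φ p.2) + p.1 • Binf

/-- `C_1`, the identity matrix. -/
def matC1 : Matrix (Fin 2) (Fin 2) ℂ := 1

/-- `C_2`. -/
def matC2 : Matrix (Fin 2) (Fin 2) ℂ := !![0, 0; 1, 0]

/-- `D`. -/
def matD : Matrix (Fin 2) (Fin 2) ℂ := !![1, 0; 0, -1]

/-- `E`. -/
def matE : Matrix (Fin 2) (Fin 2) ℂ := !![0, 1; 0, 0]

/-- `A_1 = C_1`, `A_2 = C_2 + z c₀² / (1 - t_2) E`,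
`B = (-t_1 + c + α z) C_1 + (1 - t_2) C_2 + z c₀² E`.
(Here `p.1 = z`, `p.2 0 = t_1`, `p.2 1 = t_2`.) -/
noncomputable def normalFormI (c α c₀ : ℂ) : TEData 2 2 where
  A := ![fun _ => matC1, fun p => matC2 + (p.1 * c₀ ^ 2 / (1 - p.2 1)) • matE]
  B p := (-p.2 0 + c + α * p.1) • matC1 + (1 - p.2 1) • matC2 + (p.1 * c₀ ^ 2) • matE

/-- `A_1 = C_1`, `A_2 = C_2 + z ((l / c₀) t_2 + 1)^(-2 - 1/l) E`,
`B = (-t_1 + c + α z) C_1 + (l t_2 + c₀) C_2 - (z / 2) (l + 1) D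
+ z c₀ ((l / c₀) t_2 + 1)^(-1 - 1/l) E`.
The powers are those of the principal branch, with value `1` at `t_2 = 0`. -/
noncomputable def normalFormII (c α c₀ l : ℂ) : TEData 2 2 where
  A := ![fun _ => matC1,
    fun p => matC2 + (p.1 * (l / c₀ * p.2 1 + 1) ^ (-2 - 1 / l)) • matE]
  B p := (-p.2 0 + c + α * p.1) • matC1 + (l * p.2 1 + c₀) • matC2
    - (p.1 / 2 * (l + 1)) • matD
    + (p.1 * c₀ * (l / c₀ * p.2 1 + 1) ^ (-1 - 1 / l)) • matE

/-- `A_1 = C_1`, `A_2 = C_2 + z c₀² e^(-t_2) E`,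
`B = (-t_1 + c + α z) C_1 + C_2 - (z / 2) D + z c₀² e^(-t_2) E`. -/
noncomputable def normalFormIII (c α c₀ : ℂ) : TEData 2 2 where
  A := ![fun _ => matC1, fun p => matC2 + (p.1 * c₀ ^ 2 * Complex.exp (-p.2 1)) • matE]
  B p := (-p.2 0 + c + α * p.1) • matC1 + matC2 - (p.1 / 2) • matD
    + (p.1 * c₀ ^ 2 * Complex.exp (-p.2 1)) • matE

/-! Write P for (B_0)_Γ along M^univ. If dΓ = a·Id + b·P, then dP = -a·Id - b·P + b·[B_∞, P]. The
half trace ρ of P therefore splits off, and the nilpotent matrix P - ρ follows the linear flow N' =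
-N + [B_∞, N]: it is rescaled and conjugated by exp(ψ B_∞), where ψ is the time and b = dψ. So N
remains nilpotent, and (ρ, ψ) are coordinates on M^univ.

Let (1, r) be an eigenvector of B_∞, which is what `h10` expresses throughout, and let κ be its
eigenvalue minus the other one. The kernel of N is spanned by (q, rq + u). In the affine coordinate
q the fixed line (1, r) lies at infinity, so the flow on lines is affine, q' = k + κq, and the size
of N obeys X' = -(1 + κ)X. In the frame with columns (1, r) and (q, rq + u), N becomes a multiple of
C_2 and B_∞ becomes upper triangular with E-entry k + κq. The dependence of the frame on t
contributes the term z·g·E to A_2.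

It remains to replace the time by t_2 so that A_2 starts with C_2: this requires dτ/dt_2 = 1/f,
where f is the size of N, which makes f affine with slope -(1 + κ). The cases κ = 0, κ ≠ -1 and κ =
-1 are solved by elementary functions and give the three normal forms.
`IsMalgrangeChart.exists_coordinates` integrates the flow in an arbitrary chart,
`IsMalgrangeChart.isomorphic_reducedForm` performs the gauge and coordinate change, and
`exists_malgrangeChart` produces a chart. -/

/-! ### Directional derivatives and locally constant functions -/

section LineDerivatives

variable {V : Type*} [NormedAddCommGroup V] [NormedSpace ℂ V]

theorem DifferentiableAt.hasDerivAt_line {f : V → ℂ} {t : V} (hf : DifferentiableAt ℂ f t)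
    (v : V) : HasDerivAt (fun s : ℂ => f (t + s • v)) (fderiv ℂ f t v) 0 :=
  hf.hasFDerivAt.hasLineDerivAt v

theorem DifferentiableAt.fderiv_apply_eq_of_line {f : V → ℂ} {t v : V} {d : ℂ}
    (hf : DifferentiableAt ℂ f t) (h : HasDerivAt (fun s : ℂ => f (t + s • v)) d 0) :
    fderiv ℂ f t v = d :=
  (hf.hasDerivAt_line v).unique h

theorem AnalyticAt.eventually_differentiableAt {f : V → ℂ} {p : V} (hf : AnalyticAt ℂ f p) :
    ∀ᶠ q in 𝓝 p, DifferentiableAt ℂ f q :=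
  hf.eventually_analyticAt.mono fun _ h => h.differentiableAt

theorem eventually_eq_of_fderiv_eq_zero {f : V → ℂ} {p : V} (hf : AnalyticAt ℂ f p)
    (h0 : ∀ᶠ q in 𝓝 p, ∀ v, fderiv ℂ f q v = 0) : ∀ᶠ q in 𝓝 p, f q = f p := by
  -- Convexity of the ball, hence its preconnectedness, needs a real structure.
  let _ : NormedSpace ℝ V := NormedSpace.restrictScalars ℝ ℂ V
  obtain ⟨ε, hε, hb⟩ := Metric.eventually_nhds_iff_ball.1 (hf.eventually_differentiableAt.and h0)
  filter_upwards [Metric.ball_mem_nhds p hε] with q hq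
  exact Metric.isOpen_ball.is_const_of_fderiv_eq_zero (𝕜 := ℂ)
    (convex_ball p ε).isPreconnected
    (fun x hx => (hb x hx).1.differentiableWithinAt)
    (fun x hx => ContinuousLinearMap.ext fun v => (hb x hx).2 v) hq (Metric.mem_ball_self hε)

theorem MatHolomorphicAt.eventually_differentiableAt {r : ℕ}
    {F : V → Matrix (Fin r) (Fin r) ℂ} {p : V} (hF : MatHolomorphicAt F p) :
    ∀ᶠ q in 𝓝 p, ∀ i j, DifferentiableAt ℂ (fun x => F x i j) q :=
  eventually_all.2 fun i => eventually_all.2 fun j => (hF i j).eventually_differentiableAt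

theorem MatHolomorphicAt.eventually {r : ℕ}
    {F : V → Matrix (Fin r) (Fin r) ℂ} {p : V} (hF : MatHolomorphicAt F p) :
    ∀ᶠ q in 𝓝 p, MatHolomorphicAt F q :=
  eventually_all.2 fun i => eventually_all.2 fun j => (hF i j).eventually_analyticAt

end LineDerivatives

/-! ### Functions of (z, t) that depend on t alone -/

section Product

variable {m r : ℕ}

theorem fderiv_comp_snd_apply {f : (Fin m → ℂ) → ℂ} {p : ℂ × (Fin m → ℂ)}
    (hf : DifferentiableAt ℂ f p.2) (w : ℂ × (Fin m → ℂ)) :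
    fderiv ℂ (fun q : ℂ × (Fin m → ℂ) => f q.2) p w = fderiv ℂ f p.2 w.2 := by
  have h := hf.hasFDerivAt.comp p (hasFDerivAt_snd (𝕜 := ℂ) (E := ℂ) (F := Fin m → ℂ) (p := p))
  have h' : HasFDerivAt (fun q : ℂ × (Fin m → ℂ) => f q.2) _ p := h
  rw [h'.fderiv]; rfl

theorem eventually_nhds_snd {P : (Fin m → ℂ) → Prop} (h : ∀ᶠ t in 𝓝 (0 : Fin m → ℂ), P t) :
    ∀ᶠ p in 𝓝 (0 : ℂ × (Fin m → ℂ)), P p.2 :=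
  (continuous_snd.tendsto (0 : ℂ × (Fin m → ℂ))).eventually h

theorem AnalyticAt.comp_snd_zero {f : (Fin m → ℂ) → ℂ} (hf : AnalyticAt ℂ f 0) :
    AnalyticAt ℂ (fun q : ℂ × (Fin m → ℂ) => f q.2) 0 :=
  AnalyticAt.comp (g := f) (f := Prod.snd) (x := (0 : ℂ × (Fin m → ℂ))) hf analyticAt_snd

theorem pdT_comp_snd {F : (Fin m → ℂ) → Matrix (Fin r) (Fin r) ℂ} {p : ℂ × (Fin m → ℂ)}
    (hF : ∀ k l, DifferentiableAt ℂ (fun t => F t k l) p.2) (i : Fin m) :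
    pdT i (fun q => F q.2) p = matDeriv F p.2 (Pi.single i 1) := by
  ext k l
  exact fderiv_comp_snd_apply (hF k l) (0, Pi.single i 1)

theorem pdZ_comp_snd {F : (Fin m → ℂ) → Matrix (Fin r) (Fin r) ℂ} {p : ℂ × (Fin m → ℂ)}
    (hF : ∀ k l, DifferentiableAt ℂ (fun t => F t k l) p.2) :
    pdZ (fun q => F q.2) p = 0 := by
  ext k l
  exact (fderiv_comp_snd_apply (hF k l) (1, 0)).trans (map_zero _)

end Product

/-! ### Flatness of the Malgrange connection -/

section Malgrange

variable {n : ℕ}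

theorem malgrangeB0_holomorphicAt {V : Type*} [NormedAddCommGroup V] [NormedSpace ℂ V]
    (B0 Binf : Matrix (Fin n) (Fin n) ℂ) {φ : V → Matrix (Fin n) (Fin n) ℂ} {t : V}
    (hφ : MatHolomorphicAt φ t) :
    MatHolomorphicAt (fun t => malgrangeB0 B0 Binf (φ t)) t := by
  intro i j
  simp only [malgrangeB0, Matrix.add_apply, Matrix.sub_apply, Matrix.mul_apply]
  have h := fun i j => hφ i j
  refine (analyticAt_const.sub (h i j)).add (AnalyticAt.sub ?_ ?_)
  · exact Finset.analyticAt_fun_sum _ fun m _ => analyticAt_const.mul (h m j)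
  · exact Finset.analyticAt_fun_sum _ fun m _ => (h i m).mul analyticAt_const

theorem matDeriv_malgrangeB0 {V : Type*} [NormedAddCommGroup V] [NormedSpace ℂ V]
    (B0 Binf : Matrix (Fin n) (Fin n) ℂ) {φ : V → Matrix (Fin n) (Fin n) ℂ} {t : V}
    (hφ : MatHolomorphicAt φ t) (v : V) :
    matDeriv (fun t => malgrangeB0 B0 Binf (φ t)) t v =
      -matDeriv φ t v + (Binf * matDeriv φ t v - matDeriv φ t v * Binf) := by
  ext i j
  have h := fun i j => (hφ i j).differentiableAt.hasDerivAt_line v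
  refine ((malgrangeB0_holomorphicAt B0 Binf hφ i j).differentiableAt).fderiv_apply_eq_of_line ?_
  simp only [malgrangeB0, Matrix.add_apply, Matrix.sub_apply, Matrix.mul_apply, Matrix.neg_apply]
  rw [← zero_sub]
  refine ((hasDerivAt_const _ _).sub (h i j)).add (HasDerivAt.sub ?_ ?_)
  · exact HasDerivAt.fun_sum fun m _ => (h m j).const_mul _
  · exact HasDerivAt.fun_sum fun m _ => (h i m).mul_const _

theorem commute_of_mem_adjoin_singleton {P X : Matrix (Fin n) (Fin n) ℂ}
    (hX : X ∈ Algebra.adjoin ℂ {P}) : Commute P X :=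
  Algebra.commute_of_mem_adjoin_of_forall_mem_commute (R := ℂ) (s := {P}) hX fun b hb => by
    exact Set.mem_singleton_iff.1 hb ▸ Commute.refl P

theorem commute_of_mem_adjoin_singleton₂ {P X Y : Matrix (Fin n) (Fin n) ℂ}
    (hX : X ∈ Algebra.adjoin ℂ {P}) (hY : Y ∈ Algebra.adjoin ℂ {P}) : Commute X Y :=
  Algebra.commute_of_mem_adjoin_of_forall_mem_commute (R := ℂ) (s := {P}) hY fun b hb => by
    rw [Set.mem_singleton_iff.1 hb]
    exact (commute_of_mem_adjoin_singleton hX).symm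

theorem IsMalgrangeChart.eventually_mem_adjoin {B0 Binf : Matrix (Fin n) (Fin n) ℂ}
    {φ : (Fin n → ℂ) → Matrix (Fin n) (Fin n) ℂ} (hφ : IsMalgrangeChart B0 Binf φ) :
    ∀ᶠ t in 𝓝 (0 : Fin n → ℂ), ∀ i,
      matDeriv φ t (Pi.single i 1) ∈ Algebra.adjoin ℂ {malgrangeB0 B0 Binf (φ t)} := by
  filter_upwards [hφ.tangent] with t ht i
  have h : matDeriv φ t (Pi.single i 1) ∈
      Submodule.span ℂ (Set.range fun i : Fin n => matDeriv φ t (Pi.single i 1)) :=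
    Submodule.subset_span ⟨i, rfl⟩
  rw [ht] at h
  refine (Submodule.span_le (p := Subalgebra.toSubmodule
    (Algebra.adjoin ℂ {malgrangeB0 B0 Binf (φ t)}))).2 ?_ h
  rintro _ ⟨k, rfl⟩
  exact Subalgebra.pow_mem (Algebra.adjoin ℂ {malgrangeB0 B0 Binf (φ t)})
    (Algebra.subset_adjoin (Set.mem_singleton _)) _

/-- The A_i are polynomials in (B_0)_Γ, so they commute with each other and with it, and ∂_iA_j =
∂_jA_i is the symmetry of second derivatives of φ. In the remaining equation ∂_iB = -A_i + [B_∞,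
A_i] cancels against A_i and the only surviving commutator, z[A_i, B_∞]. -/
theorem IsMalgrangeChart.isTEStructure {B0 Binf : Matrix (Fin n) (Fin n) ℂ}
    {φ : (Fin n → ℂ) → Matrix (Fin n) (Fin n) ℂ} (hφ : IsMalgrangeChart B0 Binf φ) :
    (malgrangeUniv B0 Binf φ).IsTEStructure := by
  have hA : ∀ i, ∀ t, MatHolomorphicAt φ t →
      MatHolomorphicAt (fun t => matDeriv φ t (Pi.single i 1)) t := fun i t h k l => by
    have h1 : AnalyticAt ℂ (fderiv ℂ fun q => φ q k l) t := (h k l).fderiv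
    exact ((ContinuousLinearMap.apply ℂ ℂ (Pi.single i 1)).analyticAt _).comp h1
  have hP := malgrangeB0_holomorphicAt B0 Binf hφ.holomorphic
  refine ⟨fun i k l => (hA i 0 hφ.holomorphic k l).comp_snd_zero, fun k l => ?_, fun i j => ?_,
    fun i => ?_⟩
  · exact (hP k l).comp_snd_zero.add (analyticAt_fst.mul analyticAt_const)
  · filter_upwards [eventually_nhds_snd hφ.eventually_mem_adjoin,
      eventually_nhds_snd hφ.holomorphic.eventually] with p hc hp
    have hcomm : ∀ i j, Commute ((malgrangeUniv B0 Binf φ).A i p)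
        ((malgrangeUniv B0 Binf φ).A j p) := fun i j =>
      commute_of_mem_adjoin_singleton₂ (hc i) (hc j)
    rw [(hcomm i j).eq, sub_self, add_zero, ← smul_sub]
    rw [show pdT i ((malgrangeUniv B0 Binf φ).A j) p = pdT j ((malgrangeUniv B0 Binf φ).A i) p
      from ?_, sub_self, smul_zero]
    ext k l
    have h2 : ∀ v w : Fin n → ℂ, fderiv ℂ (fun q : ℂ × (Fin n → ℂ) =>
        fderiv ℂ (fun t => φ t k l) q.2 v) p (0, w) =
        fderiv ℂ (fderiv ℂ fun t => φ t k l) p.2 w v := fun v w => by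
      have hd := (hp k l).fderiv.differentiableAt
      rw [fderiv_comp_snd_apply (f := fun t => fderiv ℂ (fun t => φ t k l) t v)
        (hd.clm_apply (differentiableAt_const v)), fderiv_clm_apply hd (differentiableAt_const v)]
      simp
    have h3 := (hp k l).contDiffAt.isSymmSndFDerivAt_of_omega
    exact (h2 _ _).trans ((h3.eq _ _).trans (h2 _ _).symm)
  · filter_upwards [eventually_nhds_snd hφ.eventually_mem_adjoin,
      eventually_nhds_snd hφ.holomorphic.eventually] with p hc hp
    have hz : pdZ ((malgrangeUniv B0 Binf φ).A i) p = 0 :=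
      pdZ_comp_snd fun k l => (hA i _ hp k l).differentiableAt
    have hB : pdT i (malgrangeUniv B0 Binf φ).B p =
        matDeriv (fun t => malgrangeB0 B0 Binf (φ t)) p.2 (Pi.single i 1) := by
      ext k l
      have hd := (malgrangeB0_holomorphicAt B0 Binf hp k l).differentiableAt
      have hd' : DifferentiableAt ℂ (fun q : ℂ × (Fin n → ℂ) =>
        malgrangeB0 B0 Binf (φ q.2) k l) p := hd.comp p differentiableAt_snd
      change fderiv ℂ (fun q : ℂ × (Fin n → ℂ) =>
        malgrangeB0 B0 Binf (φ q.2) k l + q.1 * Binf k l) p _ = _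
      rw [fderiv_fun_add hd' (differentiableAt_fst.mul_const _), add_apply,
        fderiv_comp_snd_apply hd, fderiv_mul_const differentiableAt_fst]
      simp [matDeriv, fderiv_fst]
    have hcomm : Commute ((malgrangeUniv B0 Binf φ).A i p) (malgrangeB0 B0 Binf (φ p.2)) :=
      (commute_of_mem_adjoin_singleton (hc i)).symm
    rw [hz, hB, matDeriv_malgrangeB0 B0 Binf hp]
    change _ + (_ * (malgrangeB0 B0 Binf (φ p.2) + p.1 • Binf) -
      (malgrangeB0 B0 Binf (φ p.2) + p.1 • Binf) * _) = _
    rw [mul_add, add_mul, hcomm.eq]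
    change p.1 • (-(malgrangeUniv B0 Binf φ).A i p + (Binf * (malgrangeUniv B0 Binf φ).A i p -
      (malgrangeUniv B0 Binf φ).A i p * Binf)) - _ + _ + _ = _
    simp only [smul_add, smul_sub, smul_neg, smul_zero, mul_smul_comm, smul_mul_assoc]
    abel

end Malgrange

/-! ### The flow on nilpotent matrices and the coordinates of M^univ -/

/-- The conjugate of `C_2` by the matrix `!![1, q; r, r * q + u]`. -/
noncomputable def nilpotentFamily (r u q : ℂ) : Matrix (Fin 2) (Fin 2) ℂ :=
  !![q * (u + q * r) / u, -q ^ 2 / u; (u + q * r) ^ 2 / u, -(q * (u + q * r) / u)]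

/-- Time as a function of position along q' = k + κq started at 0: a primitive of 1/(k + κq), linear
if κ = 0 and a logarithm otherwise. -/
theorem exists_local_time (k κ : ℂ) (hk : k ≠ 0) :
    ∃ ℓ : ℂ → ℂ, AnalyticAt ℂ ℓ 0 ∧ ℓ 0 = 0 ∧ ∀ᶠ q in 𝓝 (0 : ℂ),
      HasDerivAt ℓ (1 / (k + κ * q)) q ∧ k * Complex.exp (κ * ℓ q) = k + κ * q := by
  by_cases hκ : κ = 0
  · subst hκ
    refine ⟨fun q => q / k, analyticAt_id.div_const, by simp, Eventually.of_forall fun q => ?_⟩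
    simpa using (hasDerivAt_id q).div_const k
  · have hs : ∀ᶠ q in 𝓝 (0 : ℂ), 1 + κ / k * q ∈ Complex.slitPlane := by
      refine ContinuousAt.eventually_mem (by fun_prop) (Complex.isOpen_slitPlane.mem_nhds ?_)
      simp
    refine ⟨fun q => Complex.log (1 + κ / k * q) / κ, ?_, by simp, ?_⟩
    · refine AnalyticAt.div_const (AnalyticAt.clog (by fun_prop) ?_)
      simp
    · filter_upwards [hs] with q hq
      have h0 := Complex.slitPlane_ne_zero hq
      have h1 : k + κ * q ≠ 0 := fun h => h0 (by field_simp; simpa using h)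
      refine ⟨?_, ?_⟩
      · have := ((((hasDerivAt_id q).const_mul (κ / k)).const_add 1).clog hq).div_const κ
        refine HasDerivAt.congr_deriv this ?_
        simp only [id]
        field_simp
      · rw [mul_div_cancel₀ _ hκ, Complex.exp_log h0]
        field_simp

theorem exists_global_flow (k κ : ℂ) :
    ∃ Q : ℂ → ℂ, Q 0 = 0 ∧ ∀ τ, HasDerivAt Q (k + κ * Q τ) τ := by
  by_cases hκ : κ = 0
  · subst hκ
    refine ⟨fun τ => k * τ, by simp, fun τ => ?_⟩
    simpa using (hasDerivAt_id τ).const_mul k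
  · refine ⟨fun τ => k * (Complex.exp (κ * τ) - 1) / κ, by simp, fun τ => ?_⟩
    have := (((((hasDerivAt_id τ).const_mul κ).cexp).sub_const 1).const_mul k).div_const κ
    refine HasDerivAt.congr_deriv this ?_
    simp only [id]
    field_simp
    ring

theorem matDeriv_eq_sum {r n : ℕ} (φ : (Fin n → ℂ) → Matrix (Fin r) (Fin r) ℂ) (t v : Fin n → ℂ) :
    matDeriv φ t v = ∑ i, v i • matDeriv φ t (Pi.single i 1) := by
  have hv : v = ∑ i, v i • Pi.single i 1 := by
    ext i
    simp [Pi.single_apply]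
  ext k l
  rw [Matrix.sum_apply]
  change fderiv ℂ (fun q => φ q k l) t v = ∑ i, v i • fderiv ℂ (fun q => φ q k l) t (Pi.single i 1)
  conv_lhs => rw [hv, map_sum]
  simp

theorem IsMalgrangeChart.eventually_matDeriv {B0 Binf : Matrix (Fin 2) (Fin 2) ℂ}
    {φ : (Fin 2 → ℂ) → Matrix (Fin 2) (Fin 2) ℂ} (hφ : IsMalgrangeChart B0 Binf φ) :
    ∀ᶠ t in 𝓝 (0 : Fin 2 → ℂ), ∀ v, ∃ a b : ℂ,
      matDeriv φ t v = a • 1 + b • malgrangeB0 B0 Binf (φ t) := by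
  filter_upwards [hφ.tangent] with t ht v
  have h : matDeriv φ t v ∈
      Submodule.span ℂ (Set.range fun i : Fin 2 => matDeriv φ t (Pi.single i 1)) := by
    rw [matDeriv_eq_sum]
    refine Submodule.sum_mem _ fun i _ => Submodule.smul_mem _ _ ?_
    exact Submodule.subset_span (Set.mem_range_self i)
  rw [ht, Submodule.mem_span_range_iff_exists_fun] at h
  obtain ⟨w, hw⟩ := h
  refine ⟨w 0, w 1, ?_⟩
  rw [← hw, Fin.sum_univ_two]
  simp

/-- Near the base point, the residue and the tangent vectors of any chart of the integral
submanifold are expressed through half the trace `ρ` of the residue and the time `ψ` of the flow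
`Γ' = (B_0)_Γ`. -/
theorem IsMalgrangeChart.exists_coordinates {B0 Binf : Matrix (Fin 2) (Fin 2) ℂ}
    {φ : (Fin 2 → ℂ) → Matrix (Fin 2) (Fin 2) ℂ} (hφ : IsMalgrangeChart B0 Binf φ)
    {c c₀ r u : ℂ} (hB0 : B0 = !![c, 0; c₀, c]) (hc₀ : c₀ ≠ 0) (hu : u ≠ 0)
    (h01 : Binf 0 1 = c₀) (h10 : Binf 1 0 = c₀ * r ^ 2 - r / 2)
    (hdiff : Binf 0 0 - Binf 1 1 = -1 / 2) {κ k : ℂ} (hκ : κ = 2 * c₀ * r - 1 / 2)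
    (hk : k = c₀ * u) :
    ∃ ρ ψ Q : (Fin 2 → ℂ) → ℂ, AnalyticAt ℂ ρ 0 ∧ AnalyticAt ℂ ψ 0 ∧ AnalyticAt ℂ Q 0 ∧
      ρ 0 = c ∧ ψ 0 = 0 ∧ Q 0 = 0 ∧ ∀ᶠ t in 𝓝 (0 : Fin 2 → ℂ),
        malgrangeB0 B0 Binf (φ t) = ρ t • 1 +
          (c₀ / u * Complex.exp (-(1 + κ) * ψ t)) • nilpotentFamily r u (Q t) ∧
        k * Complex.exp (κ * ψ t) = k + κ * Q t ∧
        ∀ v, matDeriv φ t v = (-fderiv ℂ ρ t v) • 1 + (fderiv ℂ ψ t v *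
            (c₀ / u * Complex.exp (-(1 + κ) * ψ t))) • nilpotentFamily r u (Q t) ∧
          fderiv ℂ Q t v = fderiv ℂ ψ t v * (k + κ * Q t) := by
  have hk0 : k ≠ 0 := hk ▸ mul_ne_zero hc₀ hu
  have hPa := malgrangeB0_holomorphicAt B0 Binf hφ.holomorphic
  set P : (Fin 2 → ℂ) → Matrix (Fin 2) (Fin 2) ℂ := fun t => malgrangeB0 B0 Binf (φ t) with hP
  have hP0 : P 0 = !![c, 0; c₀, c] := by
    simp [hP, malgrangeB0, hφ.map_zero, hB0]
  have hP00 := hPa 0 0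
  have hP01 := hPa 0 1
  have hP10 := hPa 1 0
  have hP11 := hPa 1 1
  obtain ⟨ℓ, hℓ, hℓ0, hℓe⟩ := exists_local_time k κ hk0
  -- Conjugating P - ρ by !![1, 0; r, u], the frame at q = 0, gives !![Y, u·P₀₁; X, -Y]. Once this
  -- is nilpotent its kernel is spanned by (Y/X, 1), whence Q.
  set X : (Fin 2 → ℂ) → ℂ :=
    fun t => (P t 1 0 - (P t 0 0 - P t 1 1) * r - P t 0 1 * r ^ 2) / u with hX
  set Y : (Fin 2 → ℂ) → ℂ := fun t => (P t 0 0 - P t 1 1) / 2 + P t 0 1 * r with hY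
  set ρ : (Fin 2 → ℂ) → ℂ := fun t => (P t 0 0 + P t 1 1) / 2 with hρ
  set Q : (Fin 2 → ℂ) → ℂ := fun t => Y t / X t with hQ
  set ψ : (Fin 2 → ℂ) → ℂ := fun t => ℓ (Q t) with hψ
  have hX0 : X 0 = c₀ / u := by simp [hX, hP0]
  have hY0 : Y 0 = 0 := by simp [hY, hP0]
  have hQ0 : Q 0 = 0 := by simp [hQ, hY0]
  have hXne0 : X 0 ≠ 0 := hX0 ▸ div_ne_zero hc₀ hu
  have hXa : AnalyticAt ℂ X 0 := by fun_prop (disch := assumption)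
  have hYa : AnalyticAt ℂ Y 0 := by fun_prop
  have hρa : AnalyticAt ℂ ρ 0 := by fun_prop
  have hQa : AnalyticAt ℂ Q 0 := hYa.div hXa hXne0
  have hψa : AnalyticAt ℂ ψ 0 := by
    refine AnalyticAt.fun_comp ?_ hQa
    rwa [hQ0]
  have hQt : Tendsto Q (𝓝 0) (𝓝 0) := by
    have := hQa.continuousAt.tendsto
    rwa [hQ0] at this
  -- Here b is the coefficient of P in dφ(v). Since (1, r) is an eigenvector of B_∞, the equation
  -- for X closes up on its own.
  have key : ∀ᶠ t in 𝓝 (0 : Fin 2 → ℂ), ∀ v, ∃ b : ℂ,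
      matDeriv φ t v = (-fderiv ℂ ρ t v - b * ρ t) • 1 + b • P t ∧
      HasDerivAt (fun s : ℂ => X (t + s • v)) (-(b * (1 + κ) * X t)) 0 ∧
      HasDerivAt (fun s : ℂ => Y (t + s • v)) (b * (-Y t + k * X t)) 0 ∧
      HasDerivAt (fun s : ℂ => P (t + s • v) 0 1) (b * ((κ - 1) * P t 0 1 - 2 * c₀ * Y t)) 0 := by
    filter_upwards [hφ.eventually_matDeriv, hφ.holomorphic.eventually] with t ht hφt v
    obtain ⟨a, b, hab⟩ := ht v
    have hPt := malgrangeB0_holomorphicAt B0 Binf hφt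
    have hD := matDeriv_malgrangeB0 B0 Binf hφt v
    rw [hab] at hD
    have hd : ∀ i j, HasDerivAt (fun s : ℂ => P (t + s • v) i j)
        ((-(a • 1 + b • P t) + (Binf * (a • 1 + b • P t) - (a • 1 + b • P t) * Binf)) i j) 0 := by
      intro i j
      have := (hPt i j).differentiableAt.hasDerivAt_line v
      rw [← hD]
      exact this
    have hd00 := hd 0 0
    have hd01 := hd 0 1
    have hd10 := hd 1 0
    have hd11 := hd 1 1
    simp only [Matrix.add_apply, Matrix.neg_apply, Matrix.sub_apply, Matrix.mul_apply,
      Fin.sum_univ_two, Matrix.smul_apply, smul_eq_mul, Matrix.one_apply_eq, h01, h10,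
      Matrix.one_apply_ne (show (0 : Fin 2) ≠ 1 by decide),
      Matrix.one_apply_ne (show (1 : Fin 2) ≠ 0 by decide)] at hd00 hd01 hd10 hd11
    have hb00 : Binf 0 0 = Binf 1 1 - 1 / 2 := by linear_combination hdiff
    rw [hb00] at hd00 hd01 hd10
    refine ⟨b, ?_, ?_, ?_, ?_⟩
    · rw [hab]
      congr 2
      have h0 : DifferentiableAt ℂ (fun t => P t 0 0) t := (hPt 0 0).differentiableAt
      have h1 : DifferentiableAt ℂ (fun t => P t 1 1) t := (hPt 1 1).differentiableAt
      have hρd : DifferentiableAt ℂ ρ t := by fun_prop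
      rw [hρd.fderiv_apply_eq_of_line ((hd00.add hd11).div_const 2)]
      simp only [hρ]
      ring
    · have h := ((hd10.sub ((hd00.sub hd11).mul_const r)).sub (hd01.mul_const (r ^ 2))).div_const u
      refine HasDerivAt.congr_deriv h ?_
      simp only [hX, hκ]
      ring
    · have h := ((hd00.sub hd11).div_const 2).add (hd01.mul_const r)
      refine HasDerivAt.congr_deriv h ?_
      simp only [hX, hY, hk]
      field_simp
      ring
    · have h := hd01
      refine HasDerivAt.congr_deriv h ?_
      simp only [hY, hκ]
      ring
  have hXne : ∀ᶠ t in 𝓝 (0 : Fin 2 → ℂ), X t ≠ 0 := hXa.continuousAt.eventually_ne hXne0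
  -- The coefficient b is identified as dψ: the quotient rule gives dQ = b(k + κQ), and ℓ' = 1/(k +
  -- κq) undoes the factor.
  have key2 : ∀ᶠ t in 𝓝 (0 : Fin 2 → ℂ), k + κ * Q t ≠ 0 ∧ ∀ v,
      HasDerivAt (fun s : ℂ => Q (t + s • v)) (fderiv ℂ ψ t v * (k + κ * Q t)) 0 ∧
      HasDerivAt (fun s : ℂ => ψ (t + s • v)) (fderiv ℂ ψ t v) 0 ∧
      matDeriv φ t v = (-fderiv ℂ ρ t v - fderiv ℂ ψ t v * ρ t) • 1 + fderiv ℂ ψ t v • P t ∧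
      HasDerivAt (fun s : ℂ => X (t + s • v)) (-(fderiv ℂ ψ t v * (1 + κ) * X t)) 0 ∧
      HasDerivAt (fun s : ℂ => Y (t + s • v)) (fderiv ℂ ψ t v * (-Y t + k * X t)) 0 ∧
      HasDerivAt (fun s : ℂ => P (t + s • v) 0 1)
        (fderiv ℂ ψ t v * ((κ - 1) * P t 0 1 - 2 * c₀ * Y t)) 0 := by
    filter_upwards [key, hXne, hQt.eventually hℓe, hψa.eventually_differentiableAt]
      with t ht hXt hℓt hψd
    have hne : k + κ * Q t ≠ 0 := by
      rw [← hℓt.2]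
      exact mul_ne_zero hk0 (Complex.exp_ne_zero _)
    refine ⟨hne, fun v => ?_⟩
    obtain ⟨b, h1, h2, h3, h4⟩ := ht v
    have hQd : HasDerivAt (fun s : ℂ => Q (t + s • v)) (b * (k + κ * Q t)) 0 := by
      have h := h3.div h2 (by simpa using hXt)
      refine HasDerivAt.congr_deriv h ?_
      simp only [hQ, zero_smul, add_zero]
      field_simp
      ring
    have hψl : HasDerivAt (fun s : ℂ => ψ (t + s • v)) b 0 := by
      have h5 : HasDerivAt ℓ (1 / (k + κ * Q t)) (Q (t + (0 : ℂ) • v)) := by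
        simpa using hℓt.1
      have h := h5.comp (0 : ℂ) hQd
      refine HasDerivAt.congr_deriv h ?_
      field_simp
    rw [hψd.fderiv_apply_eq_of_line hψl]
    exact ⟨hQd, hψl, h1, h2, h3, h4⟩
  have hF1 : ∀ᶠ t in 𝓝 (0 : Fin 2 → ℂ), X t * Complex.exp ((1 + κ) * ψ t) = c₀ / u := by
    have ha : AnalyticAt ℂ (fun t => X t * Complex.exp ((1 + κ) * ψ t)) 0 := by fun_prop
    have h0 : ∀ᶠ t in 𝓝 (0 : Fin 2 → ℂ), ∀ v,
        fderiv ℂ (fun t => X t * Complex.exp ((1 + κ) * ψ t)) t v = 0 := by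
      filter_upwards [key2, ha.eventually_differentiableAt] with t ht hd v
      obtain ⟨-, h2, -, h4, -, -⟩ := ht.2 v
      refine hd.fderiv_apply_eq_of_line ?_
      have h := h4.mul (h2.const_mul (1 + κ)).cexp
      refine HasDerivAt.congr_deriv h ?_
      simp only [zero_smul, add_zero]
      ring
    filter_upwards [eventually_eq_of_fderiv_eq_zero ha h0] with t ht
    rw [ht, hX0, show ψ 0 = 0 by simp [hψ, hQ0, hℓ0]]
    simp
  -- Nilpotency persists: Y² + u·X·P₀₁ is minus the determinant of P - ρ. It scales by exp(-2ψ)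
  -- along the flow and vanishes at the base point.
  have hF2 : ∀ᶠ t in 𝓝 (0 : Fin 2 → ℂ),
      (Y t ^ 2 + X t * P t 0 1 * u) * Complex.exp (2 * ψ t) = 0 := by
    have ha : AnalyticAt ℂ (fun t => (Y t ^ 2 + X t * P t 0 1 * u) * Complex.exp (2 * ψ t)) 0 := by
      fun_prop
    have h0 : ∀ᶠ t in 𝓝 (0 : Fin 2 → ℂ), ∀ v,
        fderiv ℂ (fun t => (Y t ^ 2 + X t * P t 0 1 * u) * Complex.exp (2 * ψ t)) t v = 0 := by
      filter_upwards [key2, ha.eventually_differentiableAt] with t ht hd v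
      obtain ⟨-, h2, -, h4, h5, h6⟩ := ht.2 v
      refine hd.fderiv_apply_eq_of_line ?_
      have h := ((h5.pow 2).add ((h4.mul h6).mul_const u)).mul (h2.const_mul 2).cexp
      refine HasDerivAt.congr_deriv h ?_
      simp [hk]
      ring
    filter_upwards [eventually_eq_of_fderiv_eq_zero ha h0] with t ht
    rw [ht, hY0, hP0]
    simp
  refine ⟨ρ, ψ, Q, hρa, hψa, hQa, by simp [hρ, hP0], by simp [hψ, hQ0, hℓ0], hQ0, ?_⟩
  filter_upwards [key2, hXne, hQt.eventually hℓe, hF1, hF2, hQa.eventually_differentiableAt]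
    with t ht hXt hℓt h1 h2 hQd
  have hXe : c₀ / u * Complex.exp (-(1 + κ) * ψ t) = X t := by
    rw [← h1, mul_assoc, ← Complex.exp_add, show (1 + κ) * ψ t + -(1 + κ) * ψ t = 0 by ring,
      Complex.exp_zero, mul_one]
  have hW : P t 0 1 = -(Q t ^ 2 * X t / u) := by
    have := (mul_eq_zero.1 h2).resolve_right (Complex.exp_ne_zero _)
    simp only [hQ]
    field_simp
    linear_combination this
  have hYQ : Y t = Q t * X t := by
    simp only [hQ]
    field_simp
  have hPe : P t = ρ t • 1 + X t • nilpotentFamily r u (Q t) := by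
    have hXd : X t * u = P t 1 0 - (P t 0 0 - P t 1 1) * r - P t 0 1 * r ^ 2 := by
      simp only [hX]
      field_simp
    have hYd : Y t = (P t 0 0 - P t 1 1) / 2 + P t 0 1 * r := rfl
    have hρd : ρ t = (P t 0 0 + P t 1 1) / 2 := rfl
    have hm : (P t 0 0 - P t 1 1) / 2 = Q t * X t - P t 0 1 * r := by rw [← hYQ, hYd]; ring
    rw [hW] at hm hXd
    ext i j
    fin_cases i <;> fin_cases j <;>
      simp only [nilpotentFamily, Matrix.add_apply, Matrix.smul_apply, smul_eq_mul, Fin.zero_eta,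
        Fin.mk_one, Fin.isValue, Matrix.one_apply_eq, Matrix.of_apply, Matrix.cons_val',
        Matrix.cons_val_zero, Matrix.cons_val_one, Matrix.cons_val_fin_one,
        Matrix.one_apply_ne (show (0 : Fin 2) ≠ 1 by decide),
        Matrix.one_apply_ne (show (1 : Fin 2) ≠ 0 by decide)]
    · rw [hρd]
      field_simp at hm ⊢
      linear_combination hm
    · rw [hW]
      ring
    · field_simp at hm hXd ⊢
      linear_combination (-1 : ℂ) * hXd + r * hm
    · rw [hρd]
      field_simp at hm ⊢
      linear_combination -hm
  rw [hXe]
  refine ⟨hPe, hℓt.2, fun v => ⟨?_, hQd.fderiv_apply_eq_of_line (ht.2 v).1⟩⟩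
  rw [(ht.2 v).2.2.1, hPe, smul_add, smul_smul, smul_smul, ← add_assoc, ← add_smul]
  congr 2
  ring

/-! ### Lifting a coordinate change by the inverse function theorem -/

theorem exists_analytic_lift {n : ℕ} {Ψ H : (Fin n → ℂ) → (Fin n → ℂ)}
    (hΨ : AnalyticAt ℂ Ψ 0) (hΨ0 : Ψ 0 = 0) (hΨi : Function.Injective (fderiv ℂ Ψ 0))
    (hH : AnalyticAt ℂ H 0) (hH0 : H 0 = 0) (hHi : Function.Injective (fderiv ℂ H 0)) :
    ∃ h : (Fin n → ℂ) → (Fin n → ℂ), AnalyticAt ℂ h 0 ∧ h 0 = 0 ∧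
      Function.Bijective (fderiv ℂ h 0) ∧ ∀ᶠ s in 𝓝 (0 : Fin n → ℂ), Ψ (h s) = H s := by
  let e : (Fin n → ℂ) ≃L[ℂ] (Fin n → ℂ) :=
    (LinearEquiv.ofInjectiveEndo (fderiv ℂ Ψ 0).toLinearMap hΨi).toContinuousLinearEquiv
  have he : fderiv ℂ Ψ 0 = e := by ext v i; rfl
  have hs : HasStrictFDerivAt Ψ (e : (Fin n → ℂ) →L[ℂ] (Fin n → ℂ)) 0 := he ▸ hΨ.hasStrictFDerivAt
  let R := hs.toOpenPartialHomeomorph Ψ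
  have hR0 : (0 : Fin n → ℂ) ∈ R.source := hs.mem_toOpenPartialHomeomorph_source
  have hRs : AnalyticAt ℂ R.symm 0 := by
    have := R.analyticAt_symm' hR0 (i := e) hΨ he
    rwa [show R 0 = 0 from hΨ0] at this
  have hRs0 : R.symm 0 = 0 := by
    have := R.left_inv hR0
    rwa [show R 0 = 0 from hΨ0] at this
  have hh : AnalyticAt ℂ (fun s => R.symm (H s)) 0 :=
    AnalyticAt.fun_comp (by rwa [hH0]) hH
  have hinv : ∀ᶠ s in 𝓝 (0 : Fin n → ℂ), Ψ (R.symm (H s)) = H s := by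
    have hm : ∀ᶠ s in 𝓝 (0 : Fin n → ℂ), H s ∈ R.target := by
      refine hH.continuousAt.eventually_mem (R.open_target.mem_nhds ?_)
      rw [hH0, ← hΨ0]
      exact R.map_source hR0
    filter_upwards [hm] with s hs'
    exact R.right_inv hs'
  refine ⟨fun s => R.symm (H s), hh, by simp [hH0, hRs0], ?_, hinv⟩
  have hinj : Function.Injective (fderiv ℂ (fun s => R.symm (H s)) 0) := by
    have h1 : fderiv ℂ (fun s => Ψ (R.symm (H s))) 0 = fderiv ℂ H 0 :=
      Filter.EventuallyEq.fderiv_eq hinv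
    have h2 : fderiv ℂ (fun s => Ψ (R.symm (H s))) 0 =
        (fderiv ℂ Ψ (R.symm (H 0))).comp (fderiv ℂ (fun s => R.symm (H s)) 0) :=
      fderiv_fun_comp (g := Ψ) 0 (by rw [hH0, hRs0]; exact hΨ.differentiableAt) hh.differentiableAt
    intro v w hvw
    refine hHi ?_
    rw [← h1, h2, ContinuousLinearMap.comp_apply, ContinuousLinearMap.comp_apply, hvw]
  exact ⟨hinj, (LinearMap.injective_iff_surjective
    (f := (fderiv ℂ (fun s => R.symm (H s)) 0).toLinearMap)).1 hinj⟩

/-! ### Flatness of the reduced form -/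

/-- The common shape of the normal forms, with `t_2`-dependent coefficients `f`, `q`, `g`. -/
noncomputable def reducedForm (c α κ : ℂ) (f q g : ℂ → ℂ) : TEData 2 2 where
  A := ![fun _ => matC1, fun p => matC2 + (p.1 * g (p.2 1)) • matE]
  B p := (-p.2 0 + c + α * p.1) • matC1 + f (p.2 1) • matC2 + (p.1 * (κ / 2)) • matD
    + (p.1 * q (p.2 1)) • matE

/-- The equation in (t_2, z) splits into three components: C_2 gives f' = -(1 + κ), E gives q' = κg,
and D gives q = gf. The direction t_1 only shifts the scalar part. -/
theorem reducedForm_isTEStructure (c α κ : ℂ) {f q g : ℂ → ℂ} (hg : AnalyticAt ℂ g 0)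
    (hf : AnalyticAt ℂ f 0) (hq : AnalyticAt ℂ q 0)
    (h : ∀ᶠ s in 𝓝 (0 : ℂ), HasDerivAt f (-(1 + κ)) s ∧ HasDerivAt q (κ * g s) s ∧
      q s = g s * f s) :
    (reducedForm c α κ f q g).IsTEStructure := by
  have hc0 : ∀ i, AnalyticAt ℂ (fun p : ℂ × (Fin 2 → ℂ) => p.2 i) 0 := fun i =>
    AnalyticAt.comp_snd_zero (f := fun t : Fin 2 → ℂ => t i)
      ((ContinuousLinearMap.proj (R := ℂ) (φ := fun _ : Fin 2 => ℂ) i).analyticAt 0)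
  have hcomp : ∀ F : ℂ → ℂ, AnalyticAt ℂ F 0 →
      AnalyticAt ℂ (fun p : ℂ × (Fin 2 → ℂ) => F (p.2 1)) 0 := fun F hF =>
    AnalyticAt.fun_comp (g := F) (by simpa using hF) (hc0 1)
  have hz : AnalyticAt ℂ (fun p : ℂ × (Fin 2 → ℂ) => p.1) 0 := analyticAt_fst
  have hga := hcomp g hg
  have hfa := hcomp f hf
  have hqa := hcomp q hq
  have h0a := hc0 0
  have hA : ∀ i, MatHolomorphicAt ((reducedForm c α κ f q g).A i) 0 := by
    intro i k l
    fin_cases i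
    · exact analyticAt_const
    · change AnalyticAt ℂ (fun p : ℂ × (Fin 2 → ℂ) => matC2 k l + p.1 * g (p.2 1) * matE k l) 0
      fun_prop
  have hB : MatHolomorphicAt (reducedForm c α κ f q g).B 0 := by
    intro k l
    change AnalyticAt ℂ (fun p : ℂ × (Fin 2 → ℂ) => (-p.2 0 + c + α * p.1) * matC1 k l +
      f (p.2 1) * matC2 k l + p.1 * (κ / 2) * matD k l + p.1 * q (p.2 1) * matE k l) 0
    fun_prop
  have hsecond : ∀ᶠ p in 𝓝 (0 : ℂ × (Fin 2 → ℂ)), HasDerivAt f (-(1 + κ)) (p.2 1) ∧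
      HasDerivAt q (κ * g (p.2 1)) (p.2 1) ∧ q (p.2 1) = g (p.2 1) * f (p.2 1) := by
    have : Tendsto (fun p : ℂ × (Fin 2 → ℂ) => p.2 1) (𝓝 0) (𝓝 0) := by
      simpa using (hc0 1).continuousAt.tendsto
    exact this.eventually h
  have hA0 : ∀ v p, matDeriv ((reducedForm c α κ f q g).A 0) p v = 0 := by
    intro v p
    ext k l
    change fderiv ℂ (fun _ => matC1 k l) p v = 0
    simp
  have hgd : ∀ᶠ p in 𝓝 (0 : ℂ × (Fin 2 → ℂ)), DifferentiableAt ℂ g (p.2 1) := by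
    have : Tendsto (fun p : ℂ × (Fin 2 → ℂ) => p.2 1) (𝓝 0) (𝓝 0) := by
      simpa using (hc0 1).continuousAt.tendsto
    exact this.eventually hg.eventually_differentiableAt
  have hA1 : ∀ᶠ p in 𝓝 (0 : ℂ × (Fin 2 → ℂ)),
      pdT 0 ((reducedForm c α κ f q g).A 1) p = 0 ∧
      pdZ ((reducedForm c α κ f q g).A 1) p = g (p.2 1) • matE := by
    filter_upwards [(hA 1).eventually_differentiableAt, hgd] with p hp hgp
    refine ⟨?_, ?_⟩
    · ext k l
      refine (hp k l).fderiv_apply_eq_of_line ?_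
      change HasDerivAt (fun s : ℂ => matC2 k l + (p.1 + s • 0) *
        g (p.2 1 + s • (Pi.single 0 1 : Fin 2 → ℂ) 1) * matE k l) 0 0
      simpa using hasDerivAt_const (0 : ℂ) (matC2 k l + p.1 * g (p.2 1) * matE k l)
    · ext k l
      refine (hp k l).fderiv_apply_eq_of_line ?_
      change HasDerivAt (fun s : ℂ => matC2 k l + (p.1 + s • 1) *
        g (p.2 1 + s • (0 : ℂ)) * matE k l) (g (p.2 1) * matE k l) 0
      have := ((((hasDerivAt_id (0 : ℂ)).const_add p.1).mul_const (g (p.2 1))).mul_const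
        (matE k l)).const_add (matC2 k l)
      simpa using this
  have hBd : ∀ᶠ p in 𝓝 (0 : ℂ × (Fin 2 → ℂ)),
      pdT 0 (reducedForm c α κ f q g).B p = -matC1 ∧
      pdT 1 (reducedForm c α κ f q g).B p =
        (-(1 + κ)) • matC2 + (p.1 * (κ * g (p.2 1))) • matE := by
    filter_upwards [hB.eventually_differentiableAt, hsecond] with p hp hs
    refine ⟨?_, ?_⟩
    · ext k l
      refine (hp k l).fderiv_apply_eq_of_line ?_
      change HasDerivAt (fun s : ℂ => (-(p.2 0 + s • (Pi.single 0 1 : Fin 2 → ℂ) 0) + c +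
          α * (p.1 + s • 0)) * matC1 k l +
        f (p.2 1 + s • (Pi.single 0 1 : Fin 2 → ℂ) 1) * matC2 k l +
        (p.1 + s • 0) * (κ / 2) * matD k l +
        (p.1 + s • 0) * q (p.2 1 + s • (Pi.single 0 1 : Fin 2 → ℂ) 1) * matE k l) (-matC1 k l) 0
      have := (((((hasDerivAt_id (0 : ℂ)).const_add (p.2 0)).neg.add_const
        (c + α * p.1)).mul_const (matC1 k l)).add_const (f (p.2 1) * matC2 k l +
        p.1 * (κ / 2) * matD k l + p.1 * q (p.2 1) * matE k l))
      simpa [add_assoc] using this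
    · ext k l
      refine (hp k l).fderiv_apply_eq_of_line ?_
      change HasDerivAt (fun s : ℂ => (-(p.2 0 + s • (Pi.single 1 1 : Fin 2 → ℂ) 0) + c +
          α * (p.1 + s • 0)) * matC1 k l +
        f (p.2 1 + s • (Pi.single 1 1 : Fin 2 → ℂ) 1) * matC2 k l +
        (p.1 + s • 0) * (κ / 2) * matD k l +
        (p.1 + s • 0) * q (p.2 1 + s • (Pi.single 1 1 : Fin 2 → ℂ) 1) * matE k l)
        (-(1 + κ) * matC2 k l + p.1 * (κ * g (p.2 1)) * matE k l) 0
      have hline : HasDerivAt (fun s : ℂ => p.2 1 + s) 1 0 :=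
        (hasDerivAt_id (0 : ℂ)).const_add (p.2 1)
      have hfl : HasDerivAt (fun s : ℂ => f (p.2 1 + s)) (-(1 + κ)) 0 := by
        have h1 : HasDerivAt f (-(1 + κ)) (p.2 1 + 0) := by simpa using hs.1
        exact (h1.comp (0 : ℂ) hline).congr_deriv (mul_one _)
      have hql : HasDerivAt (fun s : ℂ => q (p.2 1 + s)) (κ * g (p.2 1)) 0 := by
        have h1 : HasDerivAt q (κ * g (p.2 1)) (p.2 1 + 0) := by simpa using hs.2.1
        exact (h1.comp (0 : ℂ) hline).congr_deriv (mul_one _)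
      have := (((hfl.mul_const (matC2 k l)).const_add
        ((-p.2 0 + c + α * p.1) * matC1 k l)).add_const (p.1 * (κ / 2) * matD k l)).add
        ((hql.const_mul p.1).mul_const (matE k l))
      simp only [add_zero, smul_eq_mul, Pi.single_eq_same, mul_one, ne_eq,
        Fin.isValue, zero_ne_one, not_false_eq_true, Pi.single_eq_of_ne, mul_zero]
      exact this
  have hDE : matD * matE = matE := by ext i j; fin_cases i <;> fin_cases j <;> simp [matD, matE]
  have hED : matE * matD = -matE := by ext i j; fin_cases i <;> fin_cases j <;> simp [matD, matE]
  have hDC : matD * matC2 = -matC2 := by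
    ext i j; fin_cases i <;> fin_cases j <;> simp [matD, matC2]
  have hCD : matC2 * matD = matC2 := by
    ext i j; fin_cases i <;> fin_cases j <;> simp [matD, matC2]
  have hEC : matE * matC2 = matD + matC2 * matE := by
    ext i j; fin_cases i <;> fin_cases j <;> simp [matD, matC2, matE]
  refine ⟨hA, hB, fun i j => ?_, fun i => ?_⟩
  · filter_upwards [hA1] with p hp
    have h0 : ∀ v, matDeriv ((reducedForm c α κ f q g).A 0) p v = 0 := fun v => hA0 v p
    fin_cases i <;> fin_cases j
    · simp
    · change p.1 • pdT 0 ((reducedForm c α κ f q g).A 1) p -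
        p.1 • matDeriv ((reducedForm c α κ f q g).A 0) p (0, Pi.single 1 1) +
        (matC1 * _ - _ * matC1) = 0
      rw [hp.1, h0]
      simp [matC1]
    · change p.1 • matDeriv ((reducedForm c α κ f q g).A 0) p (0, Pi.single 1 1) -
        p.1 • pdT 0 ((reducedForm c α κ f q g).A 1) p +
        (_ * matC1 - matC1 * _) = 0
      rw [hp.1, h0]
      simp [matC1]
    · simp
  · filter_upwards [hA1, hBd, hsecond] with p hp hb hs
    fin_cases i
    · change p.1 • pdT 0 (reducedForm c α κ f q g).B p -
        p.1 ^ 2 • matDeriv ((reducedForm c α κ f q g).A 0) p (1, 0) + p.1 • matC1 +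
        (matC1 * _ - _ * matC1) = 0
      rw [hb.1, hA0]
      simp [matC1]
    · change p.1 • pdT 1 (reducedForm c α κ f q g).B p -
        p.1 ^ 2 • pdZ ((reducedForm c α κ f q g).A 1) p +
        p.1 • (matC2 + (p.1 * g (p.2 1)) • matE) +
        ((matC2 + (p.1 * g (p.2 1)) • matE) * ((-p.2 0 + c + α * p.1) • matC1 +
          f (p.2 1) • matC2 + (p.1 * (κ / 2)) • matD + (p.1 * q (p.2 1)) • matE) -
          ((-p.2 0 + c + α * p.1) • matC1 + f (p.2 1) • matC2 + (p.1 * (κ / 2)) • matD +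
            (p.1 * q (p.2 1)) • matE) * (matC2 + (p.1 * g (p.2 1)) • matE)) = 0
      rw [hb.2, hp.2, hs.2.2]
      simp only [mul_add, add_mul, smul_mul_assoc, mul_smul_comm, hDE, hED, hDC, hCD, hEC, matC1,
        one_mul, mul_one, smul_smul]
      module

/-! ### The gauge transformation to the reduced form -/

/-- The frame `!![1, q; r, r * q + u]`, in which the nilpotent part of the residue is a multiple
of `C_2`. -/
def gaugeFrame (r u q : ℂ) : Matrix (Fin 2) (Fin 2) ℂ := !![1, q; r, r * q + u]

theorem nilpotentFamily_mul_gaugeFrame (r u q : ℂ) (hu : u ≠ 0) :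
    nilpotentFamily r u q * gaugeFrame r u q = gaugeFrame r u q * matC2 := by
  ext i j
  fin_cases i <;> fin_cases j <;>
    simp [nilpotentFamily, gaugeFrame, matC2, Matrix.mul_apply] <;> field_simp <;> ring

/-- The first column (1, r) is an eigenvector with eigenvalue α + κ/2, so the matrix in this frame
is upper triangular. Moving the second column by q times the first adds q times the eigenvalue
difference κ to the upper right entry. -/
theorem mul_gaugeFrame {Binf : Matrix (Fin 2) (Fin 2) ℂ} {c₀ r u α κ k : ℂ} (q : ℂ)
    (h01 : Binf 0 1 = c₀) (h10 : Binf 1 0 = c₀ * r ^ 2 - r / 2)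
    (hdiff : Binf 0 0 - Binf 1 1 = -1 / 2) (hα : α = (Binf 0 0 + Binf 1 1) / 2)
    (hκ : κ = 2 * c₀ * r - 1 / 2) (hk : k = c₀ * u) :
    Binf * gaugeFrame r u q =
      gaugeFrame r u q * (α • matC1 + (κ / 2) • matD + (k + κ * q) • matE) := by
  have h00 : Binf 0 0 = α - 1 / 4 := by linear_combination hdiff / 2 - hα
  have h11 : Binf 1 1 = α + 1 / 4 := by linear_combination -hdiff / 2 - hα
  subst hκ hk
  ext i j
  fin_cases i <;> fin_cases j <;>
    simp [gaugeFrame, matC1, matD, matE, Matrix.mul_apply, h00, h01, h10, h11] <;> ring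

theorem IsMalgrangeChart.isomorphic_reducedForm {B0 Binf : Matrix (Fin 2) (Fin 2) ℂ}
    {φ : (Fin 2 → ℂ) → Matrix (Fin 2) (Fin 2) ℂ} (hφ : IsMalgrangeChart B0 Binf φ)
    {c c₀ r u α κ k : ℂ} (hB0 : B0 = !![c, 0; c₀, c]) (hc₀ : c₀ ≠ 0) (hu : u ≠ 0)
    (h01 : Binf 0 1 = c₀) (h10 : Binf 1 0 = c₀ * r ^ 2 - r / 2)
    (hdiff : Binf 0 0 - Binf 1 1 = -1 / 2) (hα : α = (Binf 0 0 + Binf 1 1) / 2)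
    (hκ : κ = 2 * c₀ * r - 1 / 2) (hk : k = c₀ * u)
    {f q g τ : ℂ → ℂ} (hτa : AnalyticAt ℂ τ 0) (hτ0 : τ 0 = 0)
    (hτ : ∀ᶠ s in 𝓝 (0 : ℂ), HasDerivAt τ (1 / f s) s ∧ f s ≠ 0 ∧
      f s = c₀ / u * Complex.exp (-(1 + κ) * τ s) ∧ q s = k * Complex.exp (κ * τ s) ∧
      q s = g s * f s) :
    (malgrangeUniv B0 Binf φ).Isomorphic (reducedForm c α κ f q g) := by
  obtain ⟨ρ, ψ, Q, hρa, hψa, hQa, hρ0, hψ0, hQ0, hcoord⟩ :=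
    hφ.exists_coordinates hB0 hc₀ hu h01 h10 hdiff hκ hk
  have hρd := hρa.differentiableAt
  have hψd := hψa.differentiableAt
  -- the coordinates `(c - ρ, ψ)`
  set Ψ : (Fin 2 → ℂ) → (Fin 2 → ℂ) := fun t => ![c - ρ t, ψ t] with hΨ
  have hΨa : AnalyticAt ℂ Ψ 0 := by
    refine AnalyticAt.pi fun i => ?_
    fin_cases i
    · exact analyticAt_const.sub hρa
    · exact hψa
  -- By the coordinate formula dφ(v) is determined by dρ(v) and dψ(v), so the immersion property of
  -- φ carries over to (c - ρ, ψ).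
  have hΨi : Function.Injective (fderiv ℂ Ψ 0) := by
    rw [injective_iff_map_eq_zero]
    intro v hv
    have hpi : ∀ i, fderiv ℂ (fun t => Ψ t i) 0 v = 0 := by
      intro i
      have h := (hasFDerivAt_pi'.1 hΨa.differentiableAt.hasFDerivAt) i
      rw [h.fderiv, ContinuousLinearMap.comp_apply, hv]
      simp
    have h0 : fderiv ℂ ρ 0 v = 0 := by
      have h : fderiv ℂ (fun t => c - ρ t) 0 v = 0 := hpi 0
      rw [fderiv_const_sub] at h
      simpa using h
    have h1 : fderiv ℂ ψ 0 v = 0 := hpi 1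
    have h2 := (hcoord.self_of_nhds.2.2 v).1
    rw [h0, h1, matDeriv_eq_sum] at h2
    have h3 := Fintype.linearIndependent_iff.1 hφ.immersion v (by simpa using h2)
    exact funext h3
  -- The new coordinates are prescribed by c - ρ = t_1 and ψ = τ(t_2); h is the lift of H through Ψ.
  set H : (Fin 2 → ℂ) → (Fin 2 → ℂ) := fun t => ![t 0, τ (t 1)] with hH
  have hproj : ∀ i (t : Fin 2 → ℂ), HasFDerivAt (fun t : Fin 2 → ℂ => t i)
      (ContinuousLinearMap.proj (R := ℂ) (φ := fun _ : Fin 2 => ℂ) i) t :=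
    fun i t => (ContinuousLinearMap.proj (R := ℂ) (φ := fun _ : Fin 2 => ℂ) i).hasFDerivAt
  have hproja : ∀ i, AnalyticAt ℂ (fun t : Fin 2 → ℂ => t i) 0 := fun i =>
    (ContinuousLinearMap.proj (R := ℂ) (φ := fun _ : Fin 2 => ℂ) i).analyticAt 0
  have hτcd : ∀ t : Fin 2 → ℂ, HasDerivAt τ (1 / f (t 1)) (t 1) → ∀ v : Fin 2 → ℂ,
      fderiv ℂ (fun t : Fin 2 → ℂ => τ (t 1)) t v = v 1 / f (t 1) := by
    intro t ht v
    have h := ht.comp_hasFDerivAt t (hproj 1 t)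
    have h' : HasFDerivAt (fun t : Fin 2 → ℂ => τ (t 1)) _ t := h
    rw [h'.fderiv]
    simp [div_eq_inv_mul]
  have hτca : AnalyticAt ℂ (fun t : Fin 2 → ℂ => τ (t 1)) 0 :=
    AnalyticAt.fun_comp (g := τ) hτa (hproja 1)
  have hHa : AnalyticAt ℂ H 0 := by
    refine AnalyticAt.pi fun i => ?_
    fin_cases i
    · exact hproja 0
    · exact hτca
  have hHi : Function.Injective (fderiv ℂ H 0) := by
    rw [injective_iff_map_eq_zero]
    intro v hv
    have hpi : ∀ i, fderiv ℂ (fun t => H t i) 0 v = 0 := by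
      intro i
      have h := (hasFDerivAt_pi'.1 hHa.differentiableAt.hasFDerivAt) i
      rw [h.fderiv, ContinuousLinearMap.comp_apply, hv]
      simp
    have h0 : v 0 = 0 := by
      have h : fderiv ℂ (fun t : Fin 2 → ℂ => t 0) 0 v = 0 := hpi 0
      rwa [(hproj 0 0).fderiv] at h
    have h1 : fderiv ℂ (fun t : Fin 2 → ℂ => τ (t 1)) 0 v = 0 := hpi 1
    rw [hτcd 0 hτ.self_of_nhds.1] at h1
    have h2 : v 1 = 0 := (div_eq_zero_iff.1 h1).resolve_right hτ.self_of_nhds.2.1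
    ext i
    fin_cases i
    · exact h0
    · exact h2
  obtain ⟨h, hha, hh0, hhb, hlift⟩ := exists_analytic_lift hΨa
    (by ext i; fin_cases i <;> simp [hΨ, hρ0, hψ0]) hΨi hHa
    (by ext i; fin_cases i <;> simp [hH, hτ0]) hHi
  have hht : Tendsto h (𝓝 0) (𝓝 0) := by simpa [hh0] using hha.continuousAt.tendsto
  have htend1 : Tendsto (fun t : Fin 2 → ℂ => t 1) (𝓝 0) (𝓝 0) := by
    simpa using (hproja 1).continuousAt.tendsto
  have hρh : ∀ᶠ t in 𝓝 (0 : Fin 2 → ℂ), ρ (h t) = c - t 0 := by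
    filter_upwards [hlift] with t ht
    have h1 : c - ρ (h t) = t 0 := congrFun ht 0
    linear_combination -h1
  have hψh : ∀ᶠ t in 𝓝 (0 : Fin 2 → ℂ), ψ (h t) = τ (t 1) := by
    filter_upwards [hlift] with t ht
    exact congrFun ht 1
  have hQha : AnalyticAt ℂ (fun t => Q (h t)) 0 := AnalyticAt.fun_comp (by rwa [hh0]) hha
  -- the connection matrices along `h`
  have hmain : ∀ᶠ t in 𝓝 (0 : Fin 2 → ℂ), k + κ * Q (h t) = q (t 1) ∧
      malgrangeB0 B0 Binf (φ (h t)) =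
        (c - t 0) • (1 : Matrix (Fin 2) (Fin 2) ℂ) + f (t 1) • nilpotentFamily r u (Q (h t)) ∧
      ∀ i, (∑ j, fderiv ℂ h t (Pi.single i 1) j • matDeriv φ (h t) (Pi.single j 1) =
          (Pi.single i 1 : Fin 2 → ℂ) 0 • (1 : Matrix (Fin 2) (Fin 2) ℂ) +
            (Pi.single i 1 : Fin 2 → ℂ) 1 • nilpotentFamily r u (Q (h t))) ∧
        fderiv ℂ (fun t => Q (h t)) t (Pi.single i 1) =
          (Pi.single i 1 : Fin 2 → ℂ) 1 * g (t 1) := by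
    filter_upwards [hht.eventually hcoord, hρh.eventually_nhds, hψh.eventually_nhds,
      htend1.eventually hτ, hht.eventually hρa.eventually_differentiableAt,
      hht.eventually hψa.eventually_differentiableAt,
      hht.eventually hQa.eventually_differentiableAt, hha.eventually_analyticAt]
      with t hc hρt hψt hτt hρd hψd hQd hhd
    obtain ⟨hP, hexp, hdir⟩ := hc
    obtain ⟨hτ1, hf0, hf, hq, hqg⟩ := hτt
    have hhd := hhd.differentiableAt
    rw [hψt.self_of_nhds, ← hf, hρt.self_of_nhds] at hP
    rw [hψt.self_of_nhds, ← hq] at hexp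
    refine ⟨hexp.symm, hP, fun i => ?_⟩
    have hρi : fderiv ℂ ρ (h t) (fderiv ℂ h t (Pi.single i 1)) = -(Pi.single i 1 : Fin 2 → ℂ) 0 := by
      have h1 : fderiv ℂ (fun t => ρ (h t)) t = fderiv ℂ (fun t : Fin 2 → ℂ => c - t 0) t :=
        Filter.EventuallyEq.fderiv_eq hρt
      rw [fderiv_fun_comp (g := ρ) t hρd hhd, fderiv_const_sub, (hproj 0 t).fderiv] at h1
      exact DFunLike.congr_fun h1 (Pi.single i 1)
    have hψi : fderiv ℂ ψ (h t) (fderiv ℂ h t (Pi.single i 1)) =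
        (Pi.single i 1 : Fin 2 → ℂ) 1 / f (t 1) := by
      have h1 : fderiv ℂ (fun t => ψ (h t)) t = fderiv ℂ (fun t : Fin 2 → ℂ => τ (t 1)) t :=
        Filter.EventuallyEq.fderiv_eq hψt
      rw [fderiv_fun_comp (g := ψ) t hψd hhd] at h1
      rw [← hτcd t hτ1, ← h1]
      rfl
    -- The factor 1/f in dψ cancels the size f of the nilpotent part; this is the reason for τ' =
    -- 1/f.
    obtain ⟨hd1, hd2⟩ := hdir (fderiv ℂ h t (Pi.single i 1))
    rw [hψt.self_of_nhds, ← hf, hρi, hψi, neg_neg, div_mul_cancel₀ _ hf0] at hd1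
    refine ⟨by rw [← matDeriv_eq_sum, hd1], ?_⟩
    rw [fderiv_fun_comp (g := Q) t hQd hhd]
    refine hd2.trans ?_
    rw [hψi, ← hexp, hqg]
    field_simp
  have hTd : ∀ᶠ t in 𝓝 (0 : Fin 2 → ℂ), ∀ i j,
      DifferentiableAt ℂ (fun t => gaugeFrame r u (Q (h t)) i j) t := by
    filter_upwards [hQha.eventually_differentiableAt] with t ht i j
    fin_cases i <;> fin_cases j
    · exact differentiableAt_const _
    · exact ht
    · exact differentiableAt_const _
    · exact (ht.const_mul r).add_const u
  -- The gauge T is independent of z, so its z-derivative drops out of the B-equation.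
  refine ⟨fun p => gaugeFrame r u (Q p.2), h, hha, hh0, hhb, ?_, ?_, fun i => ?_, ?_⟩
  · intro i j
    have := hQa.comp_snd_zero
    fin_cases i <;> fin_cases j
    · exact analyticAt_const
    · exact this
    · exact analyticAt_const
    · exact (analyticAt_const.mul this).add analyticAt_const
  · rw [Matrix.isUnit_iff_isUnit_det]
    simp [gaugeFrame, hQ0, Matrix.det_fin_two, hu]
  · filter_upwards [eventually_nhds_snd hmain, eventually_nhds_snd hTd,
      eventually_nhds_snd hQha.eventually_differentiableAt] with p hp hT hQd
    obtain ⟨-, -, hp⟩ := hp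
    obtain ⟨hA, hQi⟩ := hp i
    -- Only the second column varies, by dQ times the first column, so dT = dQ·T·E.
    have hdT : matDeriv (fun t => gaugeFrame r u (Q (h t))) p.2 (Pi.single i 1) =
        ((Pi.single i 1 : Fin 2 → ℂ) 1 * g (p.2 1)) • (gaugeFrame r u (Q (h p.2)) * matE) := by
      rw [← hQi]
      have hl := hQd.hasDerivAt_line (Pi.single i 1)
      ext k l
      refine (hT k l).fderiv_apply_eq_of_line ?_
      fin_cases k <;> fin_cases l <;> simp [gaugeFrame, matE]
      · exact hasDerivAt_const _ _
      · exact hl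
      · exact hasDerivAt_const _ _
      · exact (hl.const_mul r).congr_deriv (mul_comm _ _)
    simp_rw [← smul_mul_assoc]
    rw [pdT_comp_snd (F := fun t => gaugeFrame r u (Q (h t))) hT, hdT, ← Finset.sum_mul]
    change p.1 • _ + (∑ j, fderiv ℂ h p.2 (Pi.single i 1) j • matDeriv φ (h p.2) (Pi.single j 1)) *
      _ - _ = 0
    rw [hA, add_mul, smul_mul_assoc, smul_mul_assoc, nilpotentFamily_mul_gaugeFrame _ _ _ hu]
    fin_cases i
    · change _ - gaugeFrame r u (Q (h p.2)) * matC1 = 0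
      simp [matC1]
    · change _ - gaugeFrame r u (Q (h p.2)) * (matC2 + (p.1 * g (p.2 1)) • matE) = 0
      simp [mul_add, smul_smul]
      module
  · filter_upwards [eventually_nhds_snd hmain, eventually_nhds_snd hTd] with p hp hT
    obtain ⟨hq, hP, -⟩ := hp
    rw [pdZ_comp_snd (F := fun t => gaugeFrame r u (Q (h t))) hT]
    change _ + (malgrangeB0 B0 Binf (φ (h p.2)) + p.1 • Binf) * _ -
      gaugeFrame r u (Q (h p.2)) * ((-p.2 0 + c + α * p.1) • matC1 + f (p.2 1) • matC2 +
        (p.1 * (κ / 2)) • matD + (p.1 * q (p.2 1)) • matE) = 0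
    rw [hP, add_mul, add_mul, smul_mul_assoc, smul_mul_assoc, smul_mul_assoc,
      mul_gaugeFrame _ h01 h10 hdiff hα hκ hk, nilpotentFamily_mul_gaugeFrame _ _ _ hu, hq]
    simp only [mul_add, mul_smul_comm, matC1, mul_one, one_mul]
    module

/-! ### Existence of the integral submanifold -/

/-- With N the explicit solution of N' = -N + [B_∞, N] and N(0) = c₀C_2, built from the nilpotent
family with u = 1, the chart is φ = t_1·Id + ∫N. Integrating the equation gives (B_0)_φ = (c -
t_1)·Id + N, so the tangent plane spanned by Id and N is the required one. -/
theorem exists_malgrangeChart {B0 Binf : Matrix (Fin 2) (Fin 2) ℂ}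
    {c c₀ r : ℂ} (hB0 : B0 = !![c, 0; c₀, c]) (hc₀ : c₀ ≠ 0)
    (h01 : Binf 0 1 = c₀) (h10 : Binf 1 0 = c₀ * r ^ 2 - r / 2)
    (hdiff : Binf 0 0 - Binf 1 1 = -1 / 2) :
    ∃ φ : (Fin 2 → ℂ) → Matrix (Fin 2) (Fin 2) ℂ, IsMalgrangeChart B0 Binf φ := by
  set κ : ℂ := 2 * c₀ * r - 1 / 2 with hκ
  obtain ⟨Q, hQ0, hQ⟩ := exists_global_flow c₀ κ
  set f : ℂ → ℂ := fun τ => c₀ * Complex.exp (-(1 + κ) * τ) with hf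
  have hfd : ∀ τ, HasDerivAt f (-(1 + κ) * f τ) τ := by
    intro τ
    have h := ((((hasDerivAt_id τ).const_mul (-(1 + κ))).cexp).const_mul c₀)
    refine HasDerivAt.congr_deriv h ?_
    simp only [hf, id]
    ring
  have hf0 : f 0 = c₀ := by simp [hf]
  have hprim : ∀ F : ℂ → ℂ, Differentiable ℂ F →
      ∃ G : ℂ → ℂ, G 0 = 0 ∧ ∀ τ, HasDerivAt G (F τ) τ := fun F hF => by
    obtain ⟨G, h0, h⟩ := hF.isExactOn_univ.with_val_at 0 0
    exact ⟨G, h0, fun τ => h τ (Set.mem_univ τ)⟩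
  set F₀₀ : ℂ → ℂ := fun τ => f τ * (Q τ * (1 + Q τ * r)) with hF₀₀
  set F₀₁ : ℂ → ℂ := fun τ => f τ * -Q τ ^ 2 with hF₀₁
  set F₁₀ : ℂ → ℂ := fun τ => f τ * (1 + Q τ * r) ^ 2 with hF₁₀
  have hd₀₀ : ∀ τ, HasDerivAt F₀₀ (-F₀₀ τ + (c₀ * F₁₀ τ - Binf 1 0 * F₀₁ τ)) τ := fun τ => by
    have h := (hfd τ).mul ((hQ τ).mul (((hQ τ).mul_const r).const_add 1))
    refine HasDerivAt.congr_deriv h ?_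
    simp only [hF₀₀, hF₀₁, hF₁₀, h10, hκ, Pi.mul_apply]
    ring
  have hd₀₁ : ∀ τ, HasDerivAt F₀₁ (-(3 / 2) * F₀₁ τ - 2 * c₀ * F₀₀ τ) τ := fun τ => by
    have h := (hfd τ).mul ((hQ τ).pow 2).neg
    refine HasDerivAt.congr_deriv h ?_
    simp only [hF₀₀, hF₀₁, hκ, Pi.neg_apply, Pi.pow_apply]
    ring
  have hd₁₀ : ∀ τ, HasDerivAt F₁₀ (-(1 / 2) * F₁₀ τ + 2 * Binf 1 0 * F₀₀ τ) τ := fun τ => by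
    have h := (hfd τ).mul ((((hQ τ).mul_const r).const_add 1).pow 2)
    refine HasDerivAt.congr_deriv h ?_
    simp only [hF₀₀, hF₁₀, h10, hκ, Pi.pow_apply]
    ring
  obtain ⟨G₀₀, hG₀₀, hG₀₀d⟩ := hprim F₀₀ fun τ => (hd₀₀ τ).differentiableAt
  obtain ⟨G₀₁, hG₀₁, hG₀₁d⟩ := hprim F₀₁ fun τ => (hd₀₁ τ).differentiableAt
  obtain ⟨G₁₀, hG₁₀, hG₁₀d⟩ := hprim F₁₀ fun τ => (hd₁₀ τ).differentiableAt
  have hconst : ∀ K : ℂ → ℂ, (∀ τ, HasDerivAt K 0 τ) → ∀ τ, K τ = K 0 := fun K hK τ =>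
    is_const_of_deriv_eq_zero (fun τ => (hK τ).differentiableAt) (fun τ => (hK τ).deriv) τ 0
  -- Integrated form of the equation for N, entry by entry. The constants are the values at time 0,
  -- where only F₁₀ = c₀ is nonzero.
  have hE₀₀ : ∀ τ, -G₀₀ τ + (c₀ * G₁₀ τ - Binf 1 0 * G₀₁ τ) - F₀₀ τ = 0 := fun τ => by
    have h := hconst _ (fun τ => ((((hG₀₀d τ).neg.add (((hG₁₀d τ).const_mul c₀).sub
      ((hG₀₁d τ).const_mul (Binf 1 0)))).sub (hd₀₀ τ)).congr_deriv (by ring))) τ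
    simpa [hG₀₀, hG₀₁, hG₁₀, hF₀₀, hQ0] using h
  have hE₀₁ : ∀ τ, -(3 / 2) * G₀₁ τ - 2 * c₀ * G₀₀ τ - F₀₁ τ = 0 := fun τ => by
    have h := hconst _ (fun τ => ((((hG₀₁d τ).const_mul (-(3 / 2))).sub
      ((hG₀₀d τ).const_mul (2 * c₀))).sub (hd₀₁ τ)).congr_deriv (by ring)) τ
    simpa [hG₀₀, hG₀₁, hF₀₁, hQ0] using h
  have hE₁₀ : ∀ τ, -(1 / 2) * G₁₀ τ + 2 * Binf 1 0 * G₀₀ τ - F₁₀ τ = -c₀ := fun τ => by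
    have h := hconst _ (fun τ => ((((hG₁₀d τ).const_mul (-(1 / 2))).add
      ((hG₀₀d τ).const_mul (2 * Binf 1 0))).sub (hd₁₀ τ)).congr_deriv (by ring)) τ
    simpa [hG₀₀, hG₁₀, hF₁₀, hQ0, hf0] using h
  set N : ℂ → Matrix (Fin 2) (Fin 2) ℂ := fun τ => !![F₀₀ τ, F₀₁ τ; F₁₀ τ, -F₀₀ τ] with hN
  set φ : (Fin 2 → ℂ) → Matrix (Fin 2) (Fin 2) ℂ := fun t =>
    !![t 0 + G₀₀ (t 1), G₀₁ (t 1); G₁₀ (t 1), t 0 - G₀₀ (t 1)] with hφ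
  have hproja : ∀ i t, AnalyticAt ℂ (fun t : Fin 2 → ℂ => t i) t := fun i t =>
    (ContinuousLinearMap.proj (R := ℂ) (φ := fun _ : Fin 2 => ℂ) i).analyticAt t
  have hcomp : ∀ {G F : ℂ → ℂ}, (∀ τ, HasDerivAt G (F τ) τ) → ∀ t : Fin 2 → ℂ,
      AnalyticAt ℂ (fun t : Fin 2 → ℂ => G (t 1)) t := fun {G F} h t =>
    AnalyticAt.fun_comp (g := G)
      ((show Differentiable ℂ G from fun τ => (h τ).differentiableAt).analyticAt _) (hproja 1 t)
  have hφa : ∀ t, MatHolomorphicAt φ t := fun t i j => by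
    fin_cases i <;> fin_cases j
    · exact (hproja 0 t).add (hcomp hG₀₀d t)
    · exact hcomp hG₀₁d t
    · exact hcomp hG₁₀d t
    · exact (hproja 0 t).sub (hcomp hG₀₀d t)
  have hφd : ∀ t v, matDeriv φ t v = v 0 • 1 + v 1 • N (t 1) := fun t v => by
    have hl : ∀ {G F : ℂ → ℂ}, (∀ τ, HasDerivAt G (F τ) τ) →
        HasDerivAt (fun s : ℂ => G (t 1 + s * v 1)) (F (t 1) * v 1) 0 := fun {G F} h => by
      have h1 : HasDerivAt G (F (t 1)) (t 1 + 0 * v 1) := by simpa using h (t 1)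
      have h2 : HasDerivAt (fun s : ℂ => t 1 + s * v 1) (v 1) 0 := by
        simpa using ((hasDerivAt_id (0 : ℂ)).mul_const (v 1)).const_add (t 1)
      exact h1.comp (0 : ℂ) h2
    have h0 : HasDerivAt (fun s : ℂ => t 0 + s * v 0) (v 0) 0 := by
      simpa using ((hasDerivAt_id (0 : ℂ)).mul_const (v 0)).const_add (t 0)
    ext i j
    refine (hφa t i j).differentiableAt.fderiv_apply_eq_of_line ?_
    fin_cases i <;> fin_cases j
    · exact (h0.add (hl hG₀₀d)).congr_deriv (by simp [hN, mul_comm])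
    · exact (hl hG₀₁d).congr_deriv (by simp [hN, mul_comm])
    · exact (hl hG₁₀d).congr_deriv (by simp [hN, mul_comm])
    · exact (h0.sub (hl hG₀₀d)).congr_deriv (by simp [hN, mul_comm, sub_eq_add_neg])
  have hP : ∀ t, malgrangeB0 B0 Binf (φ t) = (c - t 0) • 1 + N (t 1) := fun t => by
    have h00 : Binf 0 0 = Binf 1 1 - 1 / 2 := by linear_combination hdiff
    ext i j
    simp only [malgrangeB0, Matrix.add_apply, Matrix.sub_apply, Matrix.mul_apply, Fin.sum_univ_two]
    fin_cases i <;> fin_cases j <;> simp [hB0, hφ, hN, h01, h00]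
    · linear_combination hE₀₀ (t 1)
    · linear_combination hE₀₁ (t 1)
    · linear_combination hE₁₀ (t 1)
    · linear_combination -hE₀₀ (t 1)
  have hd0 : ∀ t, matDeriv φ t (Pi.single 0 1) = 1 := fun t => by simp [hφd]
  have hd1 : ∀ t, matDeriv φ t (Pi.single 1 1) = N (t 1) := fun t => by simp [hφd]
  refine ⟨φ, hφa 0, ?_, ?_, Eventually.of_forall fun t => le_antisymm ?_ ?_⟩
  · ext i j
    fin_cases i <;> fin_cases j <;> simp [hφ, hG₀₀, hG₀₁, hG₁₀]
  · refine Fintype.linearIndependent_iff.2 fun w hw => ?_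
    rw [Fin.sum_univ_two, hd0, hd1] at hw
    have h0 := congrFun (congrFun hw 0) 0
    have h1 := congrFun (congrFun hw 1) 0
    simp [hN, hF₀₀, hF₁₀, hQ0, hf0, hc₀] at h0 h1
    intro i
    fin_cases i
    · exact h0
    · exact h1
  · have h0 : (1 : Matrix (Fin 2) (Fin 2) ℂ) ∈ Submodule.span ℂ
        (Set.range fun k : Fin 2 => malgrangeB0 B0 Binf (φ t) ^ (k : ℕ)) :=
      Submodule.subset_span ⟨0, pow_zero _⟩
    have h1 : malgrangeB0 B0 Binf (φ t) ∈ Submodule.span ℂ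
        (Set.range fun k : Fin 2 => malgrangeB0 B0 Binf (φ t) ^ (k : ℕ)) :=
      Submodule.subset_span ⟨1, pow_one _⟩
    refine Submodule.span_le.2 ?_
    rintro _ ⟨i, rfl⟩
    fin_cases i
    · change matDeriv φ t (Pi.single 0 1) ∈ Submodule.span ℂ _
      rw [hd0]
      exact h0
    · have h2 := Submodule.sub_mem _ h1 (Submodule.smul_mem _ (c - t 0) h0)
      have h3 : malgrangeB0 B0 Binf (φ t) - (c - t 0) • 1 = N (t 1) := by
        rw [hP]
        abel
      rw [h3] at h2
      change matDeriv φ t (Pi.single 1 1) ∈ Submodule.span ℂ _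
      rw [hd1]
      exact h2
  · have h0 : (1 : Matrix (Fin 2) (Fin 2) ℂ) ∈ Submodule.span ℂ
        (Set.range fun i : Fin 2 => matDeriv φ t (Pi.single i 1)) :=
      Submodule.subset_span ⟨0, hd0 t⟩
    have h1 : N (t 1) ∈ Submodule.span ℂ
        (Set.range fun i : Fin 2 => matDeriv φ t (Pi.single i 1)) :=
      Submodule.subset_span ⟨1, hd1 t⟩
    refine Submodule.span_le.2 ?_
    rintro _ ⟨k, rfl⟩
    fin_cases k
    · simpa using h0
    · have h2 := Submodule.add_mem _ (Submodule.smul_mem _ (c - t 0) h0) h1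
      rw [← hP] at h2
      simpa using h2

/-! ### The three normal forms -/

theorem normalFormI_eq (c α c₀ : ℂ) : normalFormI c α c₀ =
    reducedForm c α 0 (fun s => 1 - s) (fun _ => c₀ ^ 2) (fun s => c₀ ^ 2 / (1 - s)) := by
  simp only [normalFormI, reducedForm, TEData.mk.injEq]
  refine ⟨?_, ?_⟩
  · simp only [mul_div_assoc]
  · funext p
    module

theorem normalFormII_eq (c α c₀ l : ℂ) : normalFormII c α c₀ l =
    reducedForm c α (-(l + 1)) (fun s => l * s + c₀)
      (fun s => c₀ * (l / c₀ * s + 1) ^ (-1 - 1 / l)) (fun s => (l / c₀ * s + 1) ^ (-2 - 1 / l)) := by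
  simp only [normalFormII, reducedForm, TEData.mk.injEq, true_and]
  funext p
  module

theorem normalFormIII_eq (c α c₀ : ℂ) : normalFormIII c α c₀ =
    reducedForm c α (-1) (fun _ => 1) (fun s => c₀ ^ 2 * Complex.exp (-s))
      (fun s => c₀ ^ 2 * Complex.exp (-s)) := by
  simp only [normalFormIII, reducedForm, TEData.mk.injEq]
  refine ⟨?_, ?_⟩
  · simp only [mul_assoc]
  · funext p
    module

theorem mainTheorem4 (c c₀ α l a b : ℂ) (B0 Binf : Matrix (Fin 2) (Fin 2) ℂ)
    (hB0 : B0 = c • matC1 + c₀ • matC2) (hc₀ : c₀ ≠ 0)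
    (h12 : Binf 0 1 = c₀) (hdiff : Binf 0 0 - Binf 1 1 = -1 / 2) (h21 : Binf 1 0 ≠ 0)
    (hα : α = (Binf 0 0 + Binf 1 1) / 2)
    (hsum : a + b = -1 / (2 * Binf 1 0)) (hprod : a * b = -c₀ / Binf 1 0)
    (hl : l = Binf 1 0 * (b - a) - 1) :
    (∃ φ : (Fin 2 → ℂ) → Matrix (Fin 2) (Fin 2) ℂ, IsMalgrangeChart B0 Binf φ) ∧
    ∀ φ : (Fin 2 → ℂ) → Matrix (Fin 2) (Fin 2) ℂ, IsMalgrangeChart B0 Binf φ →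
      (malgrangeUniv B0 Binf φ).IsTEStructure ∧
      (Binf 0 1 * Binf 1 0 = -1 / 16 →
        (normalFormI c α c₀).IsTEStructure ∧
        (malgrangeUniv B0 Binf φ).Isomorphic (normalFormI c α c₀)) ∧
      (Binf 0 1 * Binf 1 0 ≠ -1 / 16 → Binf 1 0 * (b - a) ≠ 1 →
        (normalFormII c α c₀ l).IsTEStructure ∧
        (malgrangeUniv B0 Binf φ).Isomorphic (normalFormII c α c₀ l)) ∧
      (Binf 0 1 * Binf 1 0 ≠ -1 / 16 → Binf 1 0 * (b - a) = 1 →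
        (normalFormIII c α c₀).IsTEStructure ∧
        (malgrangeUniv B0 Binf φ).Isomorphic (normalFormIII c α c₀)) := by
  have hB : B0 = !![c, 0; c₀, c] := by
    rw [hB0]
    ext i j
    fin_cases i <;> fin_cases j <;> simp [matC1, matC2]
  set e := Binf 1 0 with he
  -- The relations for a and b say that (a, 1) and (b, 1) are eigenvector directions of B_∞, with
  -- eigenvalues B^∞₂₂ + ea and B^∞₂₂ + eb. So κ = e(a - b) is the eigenvalue difference, λ = -κ -
  -- 1, and r below equals 1/a.
  obtain ⟨κ, hκd⟩ : ∃ κ : ℂ, κ = -(e * (b - a)) := ⟨_, rfl⟩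
  obtain ⟨r, hr⟩ : ∃ r : ℂ, r = (κ + 1 / 2) / (2 * c₀) := ⟨_, rfl⟩
  -- The discriminant of B_∞; it vanishes exactly when c₀e = -1/16.
  have hκsq : κ ^ 2 = 1 / 4 + 4 * (c₀ * e) := by
    have h1 : e * (a + b) = -1 / 2 := by rw [hsum]; field_simp
    have h2 : e * (a * b) = -c₀ := by rw [hprod]; field_simp
    rw [hκd]
    linear_combination (e * (a + b) - 1 / 2) * h1 - 4 * e * h2
  have hκr : κ = 2 * c₀ * r - 1 / 2 := by
    rw [hr]
    field_simp
    ring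
  have h10 : Binf 1 0 = c₀ * r ^ 2 - r / 2 := by
    rw [← he]
    rw [hκr] at hκsq
    have : c₀ * e = c₀ * (c₀ * r ^ 2 - r / 2) := by linear_combination -hκsq / 4
    exact mul_left_cancel₀ hc₀ this
  refine ⟨exists_malgrangeChart hB hc₀ h12 h10 hdiff, fun φ hφ =>
    ⟨hφ.isTEStructure, fun hI => ?_, fun _ hII => ?_, fun _ hIII => ?_⟩⟩
  · have hκ0 : κ = 0 := by
      rw [h12] at hI
      have : κ ^ 2 = 0 := by linear_combination hκsq + 4 * hI
      exact pow_eq_zero_iff two_ne_zero |>.1 this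
    have hs : ∀ᶠ s in 𝓝 (0 : ℂ), 1 - s ∈ Complex.slitPlane :=
      ContinuousAt.eventually_mem (by fun_prop) (Complex.isOpen_slitPlane.mem_nhds (by simp))
    -- Taking u = c₀ normalizes f(0) = c₀/u to 1 and gives k = c₀². With κ = 0, f = exp(-τ) = 1 - s
    -- forces τ = -log(1 - s).
    rw [normalFormI_eq, ← hκ0]
    refine ⟨reducedForm_isTEStructure c α κ ?_ ?_ ?_ ?_,
      hφ.isomorphic_reducedForm hB hc₀ hc₀ h12 h10 hdiff hα hκr rfl
        (τ := fun s => -Complex.log (1 - s)) ?_ (by simp) ?_⟩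
    · exact analyticAt_const.div (by fun_prop) (by simp)
    · fun_prop
    · fun_prop
    · filter_upwards [hs] with s hs
      have h0 := Complex.slitPlane_ne_zero hs
      refine ⟨?_, ?_, ?_⟩
      · exact ((hasDerivAt_id s).const_sub 1).congr_deriv (by simp [hκ0])
      · exact (hasDerivAt_const s _).congr_deriv (by simp [hκ0])
      · field_simp
    · exact AnalyticAt.neg (AnalyticAt.clog (by fun_prop) (by simp))
    · filter_upwards [hs] with s hs
      have h0 := Complex.slitPlane_ne_zero hs
      refine ⟨?_, h0, ?_, ?_, ?_⟩
      · exact (((hasDerivAt_id s).const_sub 1).clog hs).neg.congr_deriv (by simp [neg_div])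
      · simp [hκ0, Complex.exp_log h0, hc₀]
      · simp [hκ0]
        ring
      · field_simp
  · have hl0 : l ≠ 0 := fun h => hII (by linear_combination h - hl)
    have hκl : κ = -(l + 1) := by linear_combination hκd + hl
    have hs : ∀ᶠ s in 𝓝 (0 : ℂ), l / c₀ * s + 1 ∈ Complex.slitPlane :=
      ContinuousAt.eventually_mem (by fun_prop) (Complex.isOpen_slitPlane.mem_nhds (by simp))
    have hfac : ∀ s, l * s + c₀ = c₀ * (l / c₀ * s + 1) := fun s => by field_simp
    have hbase : ∀ s, HasDerivAt (fun s : ℂ => l / c₀ * s + 1) (l / c₀) s := fun s =>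
      (((hasDerivAt_id s).const_mul (l / c₀)).add_const 1).congr_deriv (mul_one _)
    have hpow : ∀ n : ℂ, AnalyticAt ℂ (fun s : ℂ => (l / c₀ * s + 1) ^ n) 0 := fun n =>
      AnalyticAt.cpow (by fun_prop) analyticAt_const (by simp)
    have hqg : ∀ s, l / c₀ * s + 1 ≠ 0 → c₀ * (l / c₀ * s + 1) ^ (-1 - 1 / l) =
        (l / c₀ * s + 1) ^ (-2 - 1 / l) * (l * s + c₀) := fun s h0 => by
      rw [hfac, show -1 - 1 / l = (-2 - 1 / l) + 1 by ring, Complex.cpow_add _ _ h0,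
        Complex.cpow_one]
      ring
    -- Here u = 1, so f(0) = k = c₀; since -(1 + κ) = l, f = c₀·exp(lτ) = ls + c₀ determines τ.
    rw [normalFormII_eq, ← hκl]
    refine ⟨reducedForm_isTEStructure c α κ (hpow _) (by fun_prop)
      (analyticAt_const.mul (hpow _)) ?_,
      hφ.isomorphic_reducedForm hB hc₀ one_ne_zero h12 h10 hdiff hα hκr rfl
        (τ := fun s => Complex.log (l / c₀ * s + 1) / l) ?_ (by simp) ?_⟩
    · filter_upwards [hs] with s hs
      have h0 := Complex.slitPlane_ne_zero hs
      refine ⟨?_, ?_, hqg s h0⟩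
      · exact (((hasDerivAt_id s).const_mul l).add_const c₀).congr_deriv (by rw [hκl]; ring)
      · refine (((hbase s).cpow_const (c := -1 - 1 / l) hs).const_mul c₀).congr_deriv ?_
        rw [show -1 - 1 / l - 1 = -2 - 1 / l by ring, hκl]
        field_simp
        ring
    · exact (AnalyticAt.clog (by fun_prop) (by simp)).div_const
    · filter_upwards [hs] with s hs
      have h0 := Complex.slitPlane_ne_zero hs
      refine ⟨?_, ?_, ?_, ?_, hqg s h0⟩
      · refine (((hbase s).clog hs).div_const l).congr_deriv ?_
        rw [hfac]
        field_simp
      · rw [hfac]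
        exact mul_ne_zero hc₀ h0
      · rw [hκl, show -(1 + -(l + 1)) * (Complex.log (l / c₀ * s + 1) / l) =
          Complex.log (l / c₀ * s + 1) by field_simp; ring, Complex.exp_log h0, hfac, div_one]
      · rw [Complex.cpow_def_of_ne_zero h0, mul_one, hκl]
        congr 2
        field_simp
        ring
  · have hκ1 : κ = -1 := by rw [hκd, hIII]
    -- For κ = -1 the size of N is constant, equal to 1 when u = c₀, so time itself serves as t_2.
    rw [normalFormIII_eq, ← hκ1]
    have hexp : ∀ s : ℂ, HasDerivAt (fun s : ℂ => c₀ ^ 2 * Complex.exp (-s))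
        (-(c₀ ^ 2 * Complex.exp (-s))) s := fun s =>
      (((hasDerivAt_id s).neg.cexp).const_mul (c₀ ^ 2)).congr_deriv (by simp)
    refine ⟨reducedForm_isTEStructure c α κ (by fun_prop) (by fun_prop) (by fun_prop)
      (Eventually.of_forall fun s => ⟨?_, ?_, (mul_one _).symm⟩),
      hφ.isomorphic_reducedForm hB hc₀ hc₀ h12 h10 hdiff hα hκr rfl
        (τ := fun s => s) analyticAt_id rfl (Eventually.of_forall fun s =>
          ⟨?_, one_ne_zero, ?_, ?_, (mul_one _).symm⟩)⟩
    · exact (hasDerivAt_const s _).congr_deriv (by simp [hκ1])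
    · exact (hexp s).congr_deriv (by simp [hκ1])
    · exact (hasDerivAt_id s).congr_deriv (by simp)
    · simp [hκ1, hc₀]
    · rw [hκ1, neg_one_mul]
      ring
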